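/- Let $\mathcal X$ be a finite set of states, $\mathcal Z$ a (possibly empty) set of absorbing terminal states, $\mathcal U$ a set of actions, $r:\mathcal X\times\mathcal U\to\mathbb R$ a reward, $\gamma\in[0,1]$ a discount factor, and for every $(x,u)$ let $\mathcal P(x,u)$ be a nonempty set of discrete probability measures on $\mathcal X\cup\mathcal Z$. Fix a deterministic policy $\pi:\mathcal X\to\mathcal U$ and transition probabilities $\hat P(\cdot|x)$ on $\mathcal X\cup\mathcal Z$ for each $x\in\mathcal X$ (the exploration chain), and a law $\nu$ on $\mathcal X$ for the initial state $x_0$. For $v\in\mathbb R^{\mathcal X}$ put $$\sigma_{\mathcal P(x,u)}v=\inf\Big\{\sum_{x'\in\mathcal X}p(x')v(x'):p\in\mathcal P(x,u)\Big\},\qquad (T^\pi v)(x)=r(x,\pi(x))+\gamma\,\sigma_{\mathcal P(x,\pi(x))}v .$$ Let $d\in\mathbb R^{\mathcal X}$. Assume the following. 1. Either $\mathcal Z=\emptyset$, all $d_j$ are positive, and $d_j=\lim_{t\to\infty}\hat P(x_t=j\mid x_0=i)$ for all $i,j\in\mathcal X$; or $\mathcal Z\ne\emptyset$, $\hat P(x_{|\mathcal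 X|}\in\mathcal Z\mid x_0=i)>0$ for all $i\in\mathcal X$, every $j\in\mathcal X$ is visited with positive probability when $x_0\sim\nu$, and $d_j=\sum_{t=0}^\infty\hat P(x_t=j)$ (with $x_0\sim\nu$) for all $j\in\mathcal X$. 2. There is $\beta\in(0,1)$ such that $\gamma\,p(x')\le\beta\,\hat P(x'|x)$ for all $x,x'\in\mathcal X$ and all $p\in\mathcal P(x,\pi(x))$. Let $\Phi\in\mathbb R^{\mathcal X\times K}$ be a matrix with rows $\phi(x)^\top$ and linearly independent columns, and let $\Pi$ be the projection onto the column space of $\Phi$ in the norm $\|v\|_d=(\sum_x d_xv(x)^2)^{1/2}$. Robust projected value iteration is $w_{k+1}=(\Phi^\top D\Phi)^{-1}\big(\Phi^\top Dr+\gamma\,\Phi^\top D\sigma_\pi(\Phi w_k)\big)$, where $D=\mathrm{diag}(d)$, $r(x)=r(x,\pi(x))$ and $(\sigma_\pi v)(x)=\sigma_{\mathcal P(x,\pi(x))}v$. Its sampled version, started at an arbitrary $w_0\in\mathbb R^K$, is $$w^N_0=w_0,\qquad w^N_{k+1}=A_N^{-1}\big(b_N+\gamma\,s_N(w^N_k)\big),$$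 where $A_N$, $b_N$, $s_N(w)$ are the averages of $\phi(x)\phi(x)^\top$, $\phi(x)r(x,\pi(x))$ and $\phi(x)\sigma_{\mathcal P(x,\pi(x))}(\Phi w)$ over the data, that is, for a function $f$ on $\mathcal X$: * if $\mathcal Z=\emptyset$, the average of $f$ is $\frac1N\sum_{t=0}^{N-1}f(x_t)$ along one trajectory $x_0,x_1,\dots$ of the Markov chain with transitions $\hat P$ and $x_0\sim\nu$; * if $\mathcal Z\neq\emptyset$, the average of $f$ is $\frac1N\sum_{m=0}^{N-1}\sum_{t<\tau_m}f(x^m_t)$, where $(x^0_t)_t,(x^1_t)_t,\dots$ are independent trajectories of the Markov chain with transitions $\hat P$ and $x^m_0\sim\nu$, and $\tau_m$ is the first time at which trajectory $m$ is in $\mathcal Z$. Then there is $w^*\in\mathbb R^K$ such that $\Phi w^*$ is the unique $V\in\mathbb R^{\mathcal X}$ with $V=\Pi T^\pi V$ (the projected robust Bellman equation), and for every $w_0$, with probability 1, $w^N_k\to w^*$ as $N\to\infty$ and $k\to\infty$ jointly. Here $A_N^{-1}$ is read as $0$ where $A_N$ is singular. -/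

import Mathlib

open MeasureTheory ProbabilityTheory Filter Topology

noncomputable section

namespace RPVI

/-- A robust Markov decision process with non-terminal states `X`, terminal states `Z` and actions
`U`. The set `unc x u` consists of the possible laws of the state that follows `x` under `u`. -/
structure RobustMDP (X Z U : Type*) where
  unc : X → U → Set (PMF (X ⊕ Z))
  unc_nonempty : ∀ x u, (unc x u).Nonempty
  reward : X → U → ℝ
  discount : ℝ
  discount_nonneg : 0 ≤ discount
  discount_le_one : discount ≤ 1

section Bellman

variable {X Z U : Type*} [Fintype X]

/-- `σ_S v = inf {pᵀ v : p ∈ S}`; terminal states have value zero and are left out of the sum. -/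
def sigma (S : Set (PMF (X ⊕ Z))) (v : X → ℝ) : ℝ :=
  sInf ((fun p : PMF (X ⊕ Z) => ∑ x, (p (Sum.inl x)).toReal * v x) '' S)

/-- The robust Bellman operator `T v = r + γ σ_π v` of a deterministic policy `π`. -/
def robustBellman (M : RobustMDP X Z U) (π : X → U) (v : X → ℝ) : X → ℝ :=
  fun x => M.reward x (π x) + M.discount * sigma (M.unc x (π x)) v

end Bellman

section Projection

variable {X : Type*} [Fintype X] {K : ℕ}

/-- The `d`-weighted Euclidean norm. -/
def weightedNorm (d v : X → ℝ) : ℝ := Real.sqrt (∑ x, d x * v x ^ 2)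

/-- The subspace spanned by the columns of the feature matrix. -/
def featureSpan (Φ : Matrix X (Fin K) ℝ) : Submodule ℝ (X → ℝ) :=
  Submodule.span ℝ (Set.range Φ.col)

/-- `p` is a point of the feature space nearest to `v` in the `d`-weighted norm. -/
def IsWeightedProj (d : X → ℝ) (Φ : Matrix X (Fin K) ℝ) (v p : X → ℝ) : Prop :=
  p ∈ featureSpan Φ ∧ ∀ q ∈ featureSpan Φ, weightedNorm d (v - p) ≤ weightedNorm d (v - q)

/-- The projection onto the feature space in the `d`-weighted norm, for positive `d`. -/
def weightedProj (d : X → ℝ) (Φ : Matrix X (Fin K) ℝ) (v : X → ℝ) : X → ℝ :=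
  Classical.epsilon (IsWeightedProj d Φ v)

/-- The coordinate scaling that turns the weighted norm into the Euclidean norm. -/
def scaleMap (d : X → ℝ) : (X → ℝ) →ₗ[ℝ] EuclideanSpace ℝ X where
  toFun v := WithLp.toLp 2 (fun x => Real.sqrt (d x) * v x)
  map_add' u v := by ext x; simp [mul_add]
  map_smul' c v := by ext x; simp [mul_left_comm]

theorem norm_scaleMap (d : X → ℝ) (hd : ∀ x, 0 < d x) (v : X → ℝ) :
    ‖scaleMap d v‖ = weightedNorm d v := by
  rw [EuclideanSpace.norm_eq, weightedNorm]
  congr 1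
  refine Finset.sum_congr rfl fun x _ => ?_
  simp [scaleMap, mul_pow, Real.sq_sqrt (hd x).le]

theorem existsUnique_isWeightedProj (d : X → ℝ) (hd : ∀ x, 0 < d x) (Φ : Matrix X (Fin K) ℝ)
    (v : X → ℝ) : ∃! p, IsWeightedProj d Φ v p := by
  have hinj : Function.Injective (scaleMap d) := by
    intro u w h
    funext x
    have hx := congrArg (fun z : EuclideanSpace ℝ X => z x) h
    simpa [scaleMap, (Real.sqrt_pos.2 (hd x)).ne'] using hx
  have key : ∀ p, IsWeightedProj d Φ v p ↔ p ∈ featureSpan Φ ∧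
      ∀ q ∈ featureSpan Φ, ‖scaleMap d v - scaleMap d p‖ ≤ ‖scaleMap d v - scaleMap d q‖ := by
    intro p
    simp only [IsWeightedProj, ← norm_scaleMap d hd, map_sub]
  set S := (featureSpan Φ).map (scaleMap d) with hS
  have horth : ∀ p ∈ featureSpan Φ, (IsWeightedProj d Φ v p ↔
      ∀ w ∈ S, inner ℝ (scaleMap d v - scaleMap d p) w = 0) := by
    intro p hp
    have hpS : scaleMap d p ∈ S := Submodule.mem_map_of_mem hp
    rw [key, ← Submodule.norm_eq_iInf_iff_real_inner_eq_zero S hpS]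
    have hbdd : BddBelow (Set.range fun w : S => ‖scaleMap d v - w‖) :=
      ⟨0, by rintro _ ⟨w, rfl⟩; exact norm_nonneg _⟩
    constructor
    · rintro ⟨_, h⟩
      refine le_antisymm (le_ciInf ?_) (ciInf_le hbdd ⟨_, hpS⟩)
      rintro ⟨w, q, hq, rfl⟩
      exact h q hq
    · intro h
      refine ⟨hp, fun q hq => ?_⟩
      rw [h]
      exact ciInf_le hbdd ⟨_, Submodule.mem_map_of_mem hq⟩
  obtain ⟨p, hp, hpe⟩ : ∃ p ∈ featureSpan Φ, scaleMap d p = S.starProjection (scaleMap d v) := by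
    exact Submodule.mem_map.1 (S.starProjection_apply_mem (scaleMap d v))
  have hp0 : ∀ w ∈ S, inner ℝ (scaleMap d v - scaleMap d p) w = 0 := by
    intro w hw
    rw [hpe]
    exact S.starProjection_inner_eq_zero _ w hw
  refine ⟨p, (horth p hp).2 hp0, fun q hq => ?_⟩
  have hq0 := (horth q hq.1).1 hq
  apply hinj
  have hmem : scaleMap d q - scaleMap d p ∈ S := by
    rw [← map_sub]
    exact Submodule.mem_map_of_mem (sub_mem hq.1 hp)
  have h1 := hp0 _ hmem
  have h2 := hq0 _ hmem
  have h3 : inner ℝ (scaleMap d q - scaleMap d p) (scaleMap d q - scaleMap d p) = (0 : ℝ) := by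
    have : scaleMap d q - scaleMap d p
        = (scaleMap d v - scaleMap d p) - (scaleMap d v - scaleMap d q) := by abel
    conv_lhs => arg 2; rw [this]
    rw [inner_sub_left, h1, h2, sub_zero]
  exact sub_eq_zero.1 (inner_self_eq_zero.1 h3)

theorem isWeightedProj_weightedProj (d : X → ℝ) (hd : ∀ x, 0 < d x) (Φ : Matrix X (Fin K) ℝ)
    (v : X → ℝ) : IsWeightedProj d Φ v (weightedProj d Φ v) :=
  Classical.epsilon_spec (existsUnique_isWeightedProj d hd Φ v).exists

end Projection

section Chain

variable {X Z : Type*}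

/-- One step of the chain with transitions `Phat`; terminal states are absorbing. -/
def step (Phat : X → PMF (X ⊕ Z)) : X ⊕ Z → PMF (X ⊕ Z) :=
  Sum.elim Phat (fun z => PMF.pure (Sum.inr z))

/-- The law of `x_t` when `x_0` has law `ν`. -/
def chainLaw (Phat : X → PMF (X ⊕ Z)) (ν : PMF X) : ℕ → PMF (X ⊕ Z)
  | 0 => ν.map Sum.inl
  | t + 1 => (chainLaw Phat ν t).bind (step Phat)

/-- The assumption on the exploration chain, which also determines the projection weights `d`.
Without terminal states, `d` is the positive limit of the `t`-step probabilities from every state.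
With terminal states, termination within `|X|` steps has positive probability from every state,
every state is visited with positive probability from the initial law `ν`, and `d j` is the
expected number of visits to `j` (the sum in `ℝ≥0∞` is finite, by the termination condition). -/
def ExplorationAssumption [Fintype X] (Phat : X → PMF (X ⊕ Z)) (ν : PMF X) (d : X → ℝ) : Prop :=
  (IsEmpty Z ∧ (∀ j, 0 < d j) ∧
    ∀ i j, Tendsto (fun t => (chainLaw Phat (PMF.pure i) t (Sum.inl j)).toReal) atTop (𝓝 (d j)))
  ∨
  (Nonempty Z ∧
    (∀ i, 0 < ∑' z : Z, chainLaw Phat (PMF.pure i) (Fintype.card X) (Sum.inr z)) ∧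
    (∀ j, ∃ t, 0 < chainLaw Phat ν t (Sum.inl j)) ∧
    ∀ j, d j = (∑' t, chainLaw Phat ν t (Sum.inl j)).toReal)

/-- The transitions in the uncertainty set are dominated by those of the exploration chain, except
for transitions to terminal states. -/
def DominationAssumption {U : Type*} (M : RobustMDP X Z U) (π : X → U)
    (Phat : X → PMF (X ⊕ Z)) : Prop :=
  ∃ β : ℝ, 0 < β ∧ β < 1 ∧ ∀ x x', ∀ p ∈ M.unc x (π x),
    M.discount * (p (Sum.inl x')).toReal ≤ β * (Phat x (Sum.inl x')).toReal

/-- `ξ` is a Markov chain with transitions `Phat` and initial law `ν`. -/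
structure IsTrajectory {Ω : Type*} [MeasurableSpace Ω] (μ : Measure Ω) (Phat : X → PMF (X ⊕ Z))
    (ν : PMF X) (ξ : ℕ → Ω → X ⊕ Z) : Prop where
  measurable : ∀ t, Measurable[_, ⊤] (ξ t)
  law : ∀ (n : ℕ) (a : ℕ → X ⊕ Z), μ {ω | ∀ t ≤ n, ξ t ω = a t} =
    chainLaw Phat ν 0 (a 0) * ∏ t ∈ Finset.range n, step Phat (a t) (a (t + 1))

/-- Independence of the trajectories `ξ 0, ξ 1, …`, as random elements of the path space. -/
def IndepTrajectories {Ω : Type*} [MeasurableSpace Ω] (μ : Measure Ω)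
    (ξ : ℕ → ℕ → Ω → X ⊕ Z) : Prop :=
  letI : MeasurableSpace (X ⊕ Z) := ⊤
  iIndepFun (fun m ω t => ξ m t ω) μ

/-- The average `(1/N) ∑_{t < N} f (x_t)` along one trajectory (`f` is zero at terminal states). -/
def pathAverage (x : ℕ → X ⊕ Z) (N : ℕ) (f : X → ℝ) : ℝ :=
  (1 / (N : ℝ)) * ∑ t ∈ Finset.range N, Sum.elim f (fun _ => 0) (x t)

/-- The first time at which a trajectory is in a terminal state. -/
def terminationTime (x : ℕ → X ⊕ Z) : ℕ := sInf {t | ∃ z, x t = Sum.inr z}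

/-- The average over the first `N` trajectories of the sum of `f` along the trajectory, up to
termination. -/
def episodeAverage (x : ℕ → ℕ → X ⊕ Z) (N : ℕ) (f : X → ℝ) : ℝ :=
  (1 / (N : ℝ)) * ∑ m ∈ Finset.range N, ∑ t ∈ Finset.range (terminationTime (x m)),
    Sum.elim f (fun _ => 0) (x m t)

end Chain

section Iteration

variable {X Z U : Type*} [Fintype X] {K : ℕ}

/-- Robust projected value iteration started at `w₀`, with the terms `Φᵀ D Φ`, `Φᵀ D r` and
`Φᵀ D σ_π(Φ w_k)` replaced by the averages `avg` of `φ(x) φ(x)ᵀ`, `φ(x) r(x, u)` and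
`φ(x) σ_{P(x, u)}(Φ w_k)`, where `φ(x)` is row `x` of `Φ` and `u = π(x)`. -/
def sampledRPVI (M : RobustMDP X Z U) (π : X → U) (Φ : Matrix X (Fin K) ℝ)
    (avg : (X → ℝ) → ℝ) (w₀ : Fin K → ℝ) : ℕ → Fin K → ℝ
  | 0 => w₀
  | k + 1 =>
    let w := sampledRPVI M π Φ avg w₀ k
    let A : Matrix (Fin K) (Fin K) ℝ := Matrix.of fun i j => avg fun x => Φ x i * Φ x j
    let b : Fin K → ℝ := fun i => avg fun x => Φ x i * M.reward x (π x)
    let s : Fin K → ℝ := fun i => avg fun x => Φ x i * sigma (M.unc x (π x)) (Φ.mulVec w)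
    A⁻¹.mulVec (b + M.discount • s)

end Iteration

end RPVI

end

open RPVI

/-! Let `P` be the substochastic matrix of exploration transitions between non-terminal states. In
both cases `d P ≤ d` entrywise: without terminal states `d` is stationary, and with them `d` is a
sum of occupation probabilities, from which a shift in time removes only the initial term. By
Cauchy–Schwarz, `P` is then nonexpansive in the `d`-norm. Domination bounds `γ |σ u - σ v|` by `β P
|u - v|`, so the robust Bellman operator is a `β`-contraction (`weightedNorm_robustBellman_sub_le`).
The projection is nonexpansive, and Banach's theorem gives the fixed point
(`exists_projected_fixedPoint`).

The data enter only through visit frequencies `c N`, because both averages are linear in `f`. A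
sampled update is the `c N`-weighted least squares fit of the Bellman image. When `c N → d`, it
perturbs the contraction by at most `ε N` times an affine function of the current error, with `ε N →
0`. Such a recursion converges jointly in `N` and `k` (`tendsto_zero_of_perturbed_contraction`,
`tendsto_sampledRPVI`).

It remains that `c N → d` almost surely. Along one trajectory, the Poisson equation `f = g - P g`
turns sums of a centered `f` into a martingale plus a bounded boundary term. The second moment of
the martingale grows at most linearly, which gives convergence along the squares, and bounded
increments fill the gaps (`ae_tendsto_pathAverage`). For episodes, the visit counts are independent
and identically distributed with mean `d j`, and the strong law applies
(`ae_tendsto_episodeAverage_single`). -/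

/-! ### Lipschitz bounds for the worst-case expectation. -/

theorem bddBelow_sigma_image {X Z : Type*} [Fintype X] (S : Set (PMF (X ⊕ Z))) (v : X → ℝ) :
    BddBelow ((fun p : PMF (X ⊕ Z) => ∑ x, (p (Sum.inl x)).toReal * v x) '' S) := by
  refine ⟨-∑ x, |v x|, ?_⟩
  rintro _ ⟨p, -, rfl⟩
  rw [← Finset.sum_neg_distrib]
  refine Finset.sum_le_sum fun x _ => ?_
  have h0 : 0 ≤ (p (Sum.inl x)).toReal := ENNReal.toReal_nonneg
  have h1 : (p (Sum.inl x)).toReal ≤ 1 := by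
    simpa using ENNReal.toReal_mono ENNReal.one_ne_top (p.coe_le_one (Sum.inl x))
  have h2 : |(p (Sum.inl x)).toReal * v x| ≤ |v x| := by
    rw [abs_mul, abs_of_nonneg h0]
    exact mul_le_of_le_one_left (abs_nonneg _) h1
  exact (abs_le.1 h2).1

theorem discount_mul_sigma_le {X Z : Type*} [Fintype X] {S : Set (PMF (X ⊕ Z))} (hS : S.Nonempty)
    {γ : ℝ} (hγ : 0 ≤ γ) {q : X → ℝ} (hq : ∀ p ∈ S, ∀ x, γ * (p (Sum.inl x)).toReal ≤ q x)
    (u v : X → ℝ) : γ * sigma S u ≤ γ * sigma S v + ∑ x, q x * |u x - v x| := by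
  have hq0 : ∀ x, 0 ≤ q x := fun x => by
    obtain ⟨p, hp⟩ := hS
    exact le_trans (mul_nonneg hγ ENNReal.toReal_nonneg) (hq p hp x)
  have hδ : 0 ≤ ∑ x, q x * |u x - v x| :=
    Finset.sum_nonneg fun x _ => mul_nonneg (hq0 x) (abs_nonneg _)
  rcases hγ.eq_or_lt with rfl | hγ
  · simpa using hδ
  -- The infimum need not be attained, so the bound is proved for every `p ∈ S` and then passed to
  -- the infimum. Only `γ * p` is dominated by `q`; hence the division by `γ` and the separate case
  -- `γ = 0`.
  have key : (γ * sigma S u - ∑ x, q x * |u x - v x|) / γ ≤ sigma S v := by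
    refine le_csInf (hS.image _) ?_
    rintro _ ⟨p, hp, rfl⟩
    have h1 : sigma S u ≤ ∑ x, (p (Sum.inl x)).toReal * u x :=
      csInf_le (bddBelow_sigma_image S u) ⟨p, hp, rfl⟩
    rw [div_le_iff₀ hγ]
    have h2 : γ * ∑ x, (p (Sum.inl x)).toReal * u x ≤
        (∑ x, (p (Sum.inl x)).toReal * v x) * γ + ∑ x, q x * |u x - v x| := by
      rw [Finset.mul_sum, Finset.sum_mul, ← Finset.sum_add_distrib]
      refine Finset.sum_le_sum fun x _ => ?_
      have h3 : γ * (p (Sum.inl x)).toReal * (u x - v x) ≤ q x * |u x - v x| :=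
        le_trans (mul_le_mul_of_nonneg_left (le_abs_self _)
          (mul_nonneg hγ.le ENNReal.toReal_nonneg))
          (mul_le_mul_of_nonneg_right (hq p hp x) (abs_nonneg _))
      linarith
    have := mul_le_mul_of_nonneg_left h1 hγ.le
    linarith
  rw [div_le_iff₀ hγ] at key
  linarith

theorem abs_discount_mul_sigma_sub_le {X Z : Type*} [Fintype X] {S : Set (PMF (X ⊕ Z))}
    (hS : S.Nonempty) {γ : ℝ} (hγ : 0 ≤ γ) {q : X → ℝ}
    (hq : ∀ p ∈ S, ∀ x, γ * (p (Sum.inl x)).toReal ≤ q x) (u v : X → ℝ) :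
    |γ * sigma S u - γ * sigma S v| ≤ ∑ x, q x * |u x - v x| := by
  have h1 := discount_mul_sigma_le hS hγ hq u v
  have h2 := discount_mul_sigma_le hS hγ hq v u
  simp only [abs_sub_comm (v _) (u _)] at h2
  rw [abs_le]
  constructor <;> linarith

/-! ### The weighted norm and superinvariant weights. -/

section Weighted

variable {X : Type*} [Fintype X]

theorem weightedNorm_nonneg (d v : X → ℝ) : 0 ≤ weightedNorm d v := Real.sqrt_nonneg _

theorem weightedNorm_sq {d : X → ℝ} (hd : ∀ x, 0 < d x) (v : X → ℝ) :
    weightedNorm d v ^ 2 = ∑ x, d x * v x ^ 2 :=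
  Real.sq_sqrt (Finset.sum_nonneg fun x _ => mul_nonneg (hd x).le (sq_nonneg _))

theorem weightedNorm_add_le {d : X → ℝ} (hd : ∀ x, 0 < d x) (u v : X → ℝ) :
    weightedNorm d (u + v) ≤ weightedNorm d u + weightedNorm d v := by
  simp only [← norm_scaleMap d hd, map_add]
  exact norm_add_le _ _

/-- Substochastic averaging does not increase the norm weighted by a superinvariant vector. -/
theorem weightedNorm_le_of_abs_le {d : X → ℝ} (hd : ∀ x, 0 < d x) {P : Matrix X X ℝ}
    (hP0 : ∀ i j, 0 ≤ P i j) (hP1 : ∀ i, ∑ j, P i j ≤ 1) (hdP : ∀ j, ∑ i, d i * P i j ≤ d j)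
    {β : ℝ} (hβ : 0 ≤ β) {u v : X → ℝ} (h : ∀ i, |u i| ≤ β * ∑ j, P i j * |v j|) :
    weightedNorm d u ≤ β * weightedNorm d v := by
  refine le_of_sq_le_sq ?_ (mul_nonneg hβ (weightedNorm_nonneg _ _))
  rw [mul_pow, weightedNorm_sq hd, weightedNorm_sq hd]
  have hrow : ∀ i, u i ^ 2 ≤ β ^ 2 * ∑ j, P i j * v j ^ 2 := by
    intro i
    -- Cauchy–Schwarz with weights `P i j`; a row sum of at most one then makes it Jensen's
    -- inequality.
    have hcs : (∑ j, P i j * |v j|) ^ 2 ≤ (∑ j, P i j) * ∑ j, P i j * v j ^ 2 := by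
      refine Finset.sum_sq_le_sum_mul_sum_of_sq_le_mul _ (fun j _ => hP0 i j)
        (fun j _ => mul_nonneg (hP0 i j) (sq_nonneg _)) fun j _ => ?_
      rw [mul_pow, sq_abs]
      exact le_of_eq (by ring)
    have h2 : (∑ j, P i j) * ∑ j, P i j * v j ^ 2 ≤ ∑ j, P i j * v j ^ 2 :=
      mul_le_of_le_one_left (Finset.sum_nonneg fun j _ => mul_nonneg (hP0 i j) (sq_nonneg _))
        (hP1 i)
    calc u i ^ 2 = |u i| ^ 2 := (sq_abs _).symm
      _ ≤ (β * ∑ j, P i j * |v j|) ^ 2 := pow_le_pow_left₀ (abs_nonneg _) (h i) 2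
      _ = β ^ 2 * (∑ j, P i j * |v j|) ^ 2 := mul_pow _ _ _
      _ ≤ _ := mul_le_mul_of_nonneg_left (hcs.trans h2) (sq_nonneg _)
  calc ∑ i, d i * u i ^ 2 ≤ ∑ i, d i * (β ^ 2 * ∑ j, P i j * v j ^ 2) :=
        Finset.sum_le_sum fun i _ => mul_le_mul_of_nonneg_left (hrow i) (hd i).le
    _ = β ^ 2 * ∑ j, (∑ i, d i * P i j) * v j ^ 2 := by
        simp only [Finset.mul_sum, Finset.sum_mul]
        rw [Finset.sum_comm]
        refine Finset.sum_congr rfl fun j _ => Finset.sum_congr rfl fun i _ => ?_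
        ring
    _ ≤ β ^ 2 * ∑ j, d j * v j ^ 2 :=
        mul_le_mul_of_nonneg_left (Finset.sum_le_sum fun j _ =>
          mul_le_mul_of_nonneg_right (hdP j) (sq_nonneg _)) (sq_nonneg _)

theorem weightedNorm_eq_zero {d : X → ℝ} (hd : ∀ x, 0 < d x) {v : X → ℝ}
    (h : weightedNorm d v = 0) : v = 0 := by
  have h2 := weightedNorm_sq hd v
  rw [h, eq_comm, zero_pow two_ne_zero,
    Finset.sum_eq_zero_iff_of_nonneg fun x _ => mul_nonneg (hd x).le (sq_nonneg _)] at h2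
  funext x
  simpa [(hd x).ne'] using h2 x (Finset.mem_univ x)

end Weighted

theorem mem_featureSpan_iff {X : Type*} {K : ℕ} {Φ : Matrix X (Fin K) ℝ} {v : X → ℝ} :
    v ∈ featureSpan Φ ↔ ∃ a, Φ.mulVec a = v := by
  rw [featureSpan, ← Matrix.range_mulVecLin]
  simp

/-! ### Weighted least squares and the projection. -/

section Regression

variable {X : Type*} [Fintype X] {K : ℕ} (Φ : Matrix X (Fin K) ℝ)

/-- The Gram matrix `Φᵀ diag(c) Φ`. -/
def weightedGram (c : X → ℝ) : Matrix (Fin K) (Fin K) ℝ :=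
  Matrix.of fun i j => ∑ x, c x * (Φ x i * Φ x j)

/-- The vector `Φᵀ diag(c) u`. -/
def weightedMoment (c u : X → ℝ) : Fin K → ℝ := fun i => ∑ x, c x * (Φ x i * u x)

/-- The coefficients of the `c`-weighted least squares fit of `u` by the columns of `Φ`. -/
noncomputable def leastSquares (c u : X → ℝ) : Fin K → ℝ :=
  (weightedGram Φ c)⁻¹.mulVec (weightedMoment Φ c u)

theorem weightedGram_mulVec (c : X → ℝ) (a : Fin K → ℝ) :
    (weightedGram Φ c).mulVec a = weightedMoment Φ c (Φ.mulVec a) := by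
  funext i
  simp only [Matrix.mulVec, dotProduct, weightedGram, weightedMoment, Matrix.of_apply,
    Finset.sum_mul, Finset.mul_sum]
  rw [Finset.sum_comm]
  exact Finset.sum_congr rfl fun x _ => Finset.sum_congr rfl fun j _ => by ring

theorem dotProduct_weightedMoment (c u : X → ℝ) (a : Fin K → ℝ) :
    ∑ i, a i * weightedMoment Φ c u i = ∑ x, c x * (Φ.mulVec a x * u x) := by
  simp only [Matrix.mulVec, dotProduct, weightedMoment, Finset.sum_mul, Finset.mul_sum]
  rw [Finset.sum_comm]
  exact Finset.sum_congr rfl fun x _ => Finset.sum_congr rfl fun j _ => by ring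

variable {Φ}

/-- If the Gram matrix kills `a`, then pairing with `a` gives `‖Φ a‖² = 0` in the weighted norm,
hence `a = 0`. -/
theorem isUnit_det_weightedGram (hΦ : LinearIndependent ℝ Φ.col) {d : X → ℝ}
    (hd : ∀ x, 0 < d x) : IsUnit (weightedGram Φ d).det := by
  rw [← Matrix.isUnit_iff_isUnit_det, ← Matrix.mulVec_injective_iff_isUnit]
  refine (injective_iff_map_eq_zero (weightedGram Φ d).mulVecLin).2 fun a ha => ?_
  rw [Matrix.mulVecLin_apply, weightedGram_mulVec] at ha
  have h := dotProduct_weightedMoment Φ d (Φ.mulVec a) a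
  rw [ha] at h
  have h0 : weightedNorm d (Φ.mulVec a) ^ 2 = 0 := by
    rw [weightedNorm_sq hd]
    simpa [sq] using h.symm
  apply Matrix.mulVec_injective_iff.2 hΦ
  rw [weightedNorm_eq_zero hd (pow_eq_zero_iff two_ne_zero |>.1 h0), Matrix.mulVec_zero]

theorem weightedMoment_mulVec_leastSquares (hΦ : LinearIndependent ℝ Φ.col) {d : X → ℝ}
    (hd : ∀ x, 0 < d x) (v : X → ℝ) :
    weightedMoment Φ d (Φ.mulVec (leastSquares Φ d v)) = weightedMoment Φ d v := by
  rw [← weightedGram_mulVec, leastSquares, Matrix.mulVec_mulVec,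
    Matrix.mul_nonsing_inv _ (isUnit_det_weightedGram hΦ hd), Matrix.one_mulVec]

/-- Pythagoras: by the normal equations the residual is orthogonal to the column space. Dropping one
summand or the other gives minimality of the fit and, with `a = 0`, nonexpansiveness. -/
theorem weightedNorm_sub_mulVec_sq (hΦ : LinearIndependent ℝ Φ.col) {d : X → ℝ}
    (hd : ∀ x, 0 < d x) (v : X → ℝ) (a : Fin K → ℝ) :
    weightedNorm d (v - Φ.mulVec a) ^ 2 = weightedNorm d (v - Φ.mulVec (leastSquares Φ d v)) ^ 2
      + weightedNorm d (Φ.mulVec (leastSquares Φ d v) - Φ.mulVec a) ^ 2 := by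
  set b := leastSquares Φ d v
  have h1 := dotProduct_weightedMoment Φ d v (b - a)
  have h2 := dotProduct_weightedMoment Φ d (Φ.mulVec b) (b - a)
  rw [weightedMoment_mulVec_leastSquares hΦ hd, h1, Matrix.mulVec_sub] at h2
  simp only [weightedNorm_sq hd]
  have h3 : ∑ x, d x * ((Φ.mulVec b - Φ.mulVec a) x * (v x - Φ.mulVec b x)) = 0 := by
    rw [← sub_eq_zero, ← Finset.sum_sub_distrib] at h2
    rw [← h2]
    exact Finset.sum_congr rfl fun x _ => by ring
  have h4 : ∀ x, d x * (v - Φ.mulVec a) x ^ 2 = d x * (v - Φ.mulVec b) x ^ 2 +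
      d x * (Φ.mulVec b - Φ.mulVec a) x ^ 2 +
      2 * (d x * ((Φ.mulVec b - Φ.mulVec a) x * (v x - Φ.mulVec b x))) := by
    intro x
    simp only [Pi.sub_apply]
    ring
  rw [Finset.sum_congr rfl fun x _ => h4 x, Finset.sum_add_distrib, Finset.sum_add_distrib,
    ← Finset.mul_sum, h3, mul_zero, add_zero]

theorem weightedProj_eq_mulVec_leastSquares (hΦ : LinearIndependent ℝ Φ.col) {d : X → ℝ}
    (hd : ∀ x, 0 < d x) (v : X → ℝ) : weightedProj d Φ v = Φ.mulVec (leastSquares Φ d v) := by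
  refine (existsUnique_isWeightedProj d hd Φ v).unique (isWeightedProj_weightedProj d hd Φ v)
    ⟨mem_featureSpan_iff.2 ⟨_, rfl⟩, fun q hq => ?_⟩
  obtain ⟨a, rfl⟩ := mem_featureSpan_iff.1 hq
  refine le_of_sq_le_sq ?_ (weightedNorm_nonneg _ _)
  rw [weightedNorm_sub_mulVec_sq hΦ hd v a]
  exact le_add_of_nonneg_right (sq_nonneg _)

theorem weightedNorm_mulVec_leastSquares_le (hΦ : LinearIndependent ℝ Φ.col) {d : X → ℝ}
    (hd : ∀ x, 0 < d x) (v : X → ℝ) :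
    weightedNorm d (Φ.mulVec (leastSquares Φ d v)) ≤ weightedNorm d v := by
  refine le_of_sq_le_sq ?_ (weightedNorm_nonneg _ _)
  have h := weightedNorm_sub_mulVec_sq hΦ hd v 0
  rw [Matrix.mulVec_zero, sub_zero, sub_zero] at h
  rw [h]
  exact le_add_of_nonneg_left (sq_nonneg _)

theorem weightedMoment_sub (c u v : X → ℝ) :
    weightedMoment Φ c (u - v) = weightedMoment Φ c u - weightedMoment Φ c v := by
  funext i
  simp [weightedMoment, mul_sub]

theorem leastSquares_sub (c u v : X → ℝ) :
    leastSquares Φ c (u - v) = leastSquares Φ c u - leastSquares Φ c v := by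
  rw [leastSquares, weightedMoment_sub, Matrix.mulVec_sub, leastSquares, leastSquares]

end Regression

/-! ### Joint limits of perturbed contractions. -/

/-- Once `ε N ≤ (1 - β) / 2`, the part of the perturbation proportional to the error is absorbed
into the factor `b = (1 + β) / 2 < 1`. Unrolling leaves a geometric term in `k` alone plus a term in
`N` alone, so the limit is joint. The bound `C₀` on the initial errors must be uniform in `N`. -/
theorem tendsto_zero_of_perturbed_contraction {e : ℕ → ℕ → ℝ} {ε : ℕ → ℝ} {β C C₀ : ℝ}
    (hβ0 : 0 ≤ β) (hβ1 : β < 1) (hC : 0 ≤ C) (he : ∀ N k, 0 ≤ e N k) (he0 : ∀ N, e N 0 ≤ C₀)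
    (hε0 : ∀ N, 0 ≤ ε N) (hε : Tendsto ε atTop (𝓝 0))
    (hstep : ∀ N k, e N (k + 1) ≤ β * e N k + ε N * (C + e N k)) :
    Tendsto (fun q : ℕ × ℕ => e q.1 q.2) (atTop ×ˢ atTop) (𝓝 0) := by
  set b := (1 + β) / 2 with hb
  have hb0 : 0 ≤ b := by positivity
  have hb1 : b < 1 := by linarith
  have hbound : ∀ N, ε N ≤ (1 - β) / 2 → ∀ k, e N k ≤ b ^ k * C₀ + ε N * C / (1 - b) := by
    intro N hN k
    have hpos : 0 ≤ ε N * C / (1 - b) := div_nonneg (mul_nonneg (hε0 N) hC) (by linarith)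
    induction k with
    | zero => simpa using (he0 N).trans (le_add_of_nonneg_right hpos)
    | succ k ih =>
      have h1 : e N (k + 1) ≤ b * e N k + ε N * C := by
        have := mul_le_mul_of_nonneg_right hN (he N k)
        have h2 := hstep N k
        rw [hb]
        linarith
      have h3 : b * e N k ≤ b * (b ^ k * C₀ + ε N * C / (1 - b)) :=
        mul_le_mul_of_nonneg_left ih hb0
      have h4 : ε N * C = (1 - b) * (ε N * C / (1 - b)) := by
        field_simp [(by linarith : (1 - b) ≠ 0)]
      rw [pow_succ]
      linarith
  have hev : ∀ᶠ q : ℕ × ℕ in (atTop : Filter ℕ) ×ˢ (atTop : Filter ℕ),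
      ε q.1 ≤ (1 - β) / 2 :=
    tendsto_fst.eventually (hε.eventually_le_const (by linarith))
  have hlim : Tendsto (fun q : ℕ × ℕ => b ^ q.2 * C₀ + ε q.1 * C / (1 - b)) (atTop ×ˢ atTop)
      (𝓝 0) := by
    have h1 := ((tendsto_pow_atTop_nhds_zero_of_lt_one hb0 hb1).comp
      (tendsto_snd (f := (atTop : Filter ℕ)) (g := (atTop : Filter ℕ)))).mul_const C₀
    have h2 := ((hε.comp (tendsto_fst (f := (atTop : Filter ℕ)) (g := (atTop : Filter ℕ)))).mul_const
      C).div_const (1 - b)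
    simpa using h1.add h2
  exact squeeze_zero' (Eventually.of_forall fun q => he _ _)
    (hev.mono fun q hq => hbound q.1 hq q.2) hlim

/-! ### The iteration with weights converging to `d`. -/

section Deterministic

variable {X Z U : Type*} [Fintype X] {K : ℕ}

/-- The matrix of the `c`-weighted least squares fit. -/
noncomputable def fitMatrix (Φ : Matrix X (Fin K) ℝ) (c : X → ℝ) : Matrix X X ℝ :=
  Φ * (weightedGram Φ c)⁻¹ * Matrix.of fun i x => c x * Φ x i

theorem fitMatrix_mulVec (Φ : Matrix X (Fin K) ℝ) (c u : X → ℝ) :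
    (fitMatrix Φ c).mulVec u = Φ.mulVec (leastSquares Φ c u) := by
  have h : (Matrix.of fun i x => c x * Φ x i).mulVec u = weightedMoment Φ c u := by
    funext i
    simp [Matrix.mulVec, dotProduct, weightedMoment, mul_assoc]
  rw [fitMatrix, ← Matrix.mulVec_mulVec, h, ← Matrix.mulVec_mulVec, leastSquares]

theorem continuous_weightedGram (Φ : Matrix X (Fin K) ℝ) : Continuous (weightedGram Φ) :=
  continuous_matrix fun i j => by
    simp only [weightedGram, Matrix.of_apply]
    fun_prop

/-- The determinant is nonzero at `c`, hence nearby, so the value `0` of the inverse at singular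
matrices plays no part in the limit. -/
theorem continuousAt_inv_weightedGram {Φ : Matrix X (Fin K) ℝ} {c : X → ℝ}
    (hc : IsUnit (weightedGram Φ c).det) : ContinuousAt (fun c => (weightedGram Φ c)⁻¹) c := by
  have hG := continuous_weightedGram Φ
  simp only [Matrix.inv_def, Ring.inverse_eq_inv']
  exact (hG.matrix_det.continuousAt.inv₀ hc.ne_zero).smul hG.matrix_adjugate.continuousAt

theorem continuousAt_fitMatrix {Φ : Matrix X (Fin K) ℝ} {c : X → ℝ}
    (hc : IsUnit (weightedGram Φ c).det) : ContinuousAt (fitMatrix Φ) c := by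
  have hI := continuousAt_inv_weightedGram hc
  refine continuousAt_pi.2 fun x => continuousAt_pi.2 fun y => ?_
  simp only [fitMatrix, Matrix.mul_apply, Matrix.of_apply]
  refine tendsto_finsetSum _ fun i _ => Tendsto.mul (tendsto_finsetSum _ fun j _ =>
    Tendsto.mul tendsto_const_nhds ?_) ?_
  · exact ((continuous_id.matrix_elem j i).tendsto _).comp hI.tendsto
  · exact Continuous.tendsto (by fun_prop) c

/-- Cauchy–Schwarz in each row, after writing `M x y * u y` as `(M x y / √(d y)) * (√(d y) * u y)`.
The constant is a weighted Frobenius norm, so it vanishes when the entries of `M` do. -/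
theorem weightedNorm_mulVec_le {d : X → ℝ} (hd : ∀ x, 0 < d x) (M : Matrix X X ℝ) (u : X → ℝ) :
    weightedNorm d (M.mulVec u) ≤
      Real.sqrt (∑ x, ∑ y, d x * (M x y ^ 2 / d y)) * weightedNorm d u := by
  have h0 : 0 ≤ ∑ x, ∑ y, d x * (M x y ^ 2 / d y) := Finset.sum_nonneg fun x _ =>
    Finset.sum_nonneg fun y _ => mul_nonneg (hd x).le (div_nonneg (sq_nonneg _) (hd y).le)
  refine le_of_sq_le_sq ?_ (mul_nonneg (Real.sqrt_nonneg _) (weightedNorm_nonneg _ _))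
  rw [mul_pow, Real.sq_sqrt h0, weightedNorm_sq hd, weightedNorm_sq hd, Finset.sum_mul]
  refine Finset.sum_le_sum fun x _ => ?_
  rw [← Finset.mul_sum, mul_assoc]
  refine mul_le_mul_of_nonneg_left ?_ (hd x).le
  refine Finset.sum_sq_le_sum_mul_sum_of_sq_le_mul _ (fun y _ => div_nonneg (sq_nonneg _) (hd y).le)
    (fun y _ => mul_nonneg (hd y).le (sq_nonneg _)) fun y _ => le_of_eq ?_
  field_simp [(hd y).ne']

/-- Reward and worst-case terms share the feature factor, so they merge into one moment of the
Bellman image. Nothing is inverted here, so singular Gram matrices are allowed. -/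
theorem sampledRPVI_succ (M : RobustMDP X Z U) (π : X → U) (Φ : Matrix X (Fin K) ℝ) (c : X → ℝ)
    (w₀ : Fin K → ℝ) (k : ℕ) :
    sampledRPVI M π Φ (fun f => ∑ x, c x * f x) w₀ (k + 1) = leastSquares Φ c
      (robustBellman M π (Φ.mulVec (sampledRPVI M π Φ (fun f => ∑ x, c x * f x) w₀ k))) := by
  rw [sampledRPVI, leastSquares]
  congr 1
  funext i
  simp only [Pi.add_apply, Pi.smul_apply, smul_eq_mul, weightedMoment, robustBellman,
    Finset.mul_sum]
  rw [← Finset.sum_add_distrib]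
  exact Finset.sum_congr rfl fun x _ => by ring

theorem weightedNorm_robustBellman_sub_le (M : RobustMDP X Z U) (π : X → U) {d : X → ℝ}
    (hd : ∀ x, 0 < d x) {P : Matrix X X ℝ} (hP0 : ∀ i j, 0 ≤ P i j) (hP1 : ∀ i, ∑ j, P i j ≤ 1)
    (hdP : ∀ j, ∑ i, d i * P i j ≤ d j) {β : ℝ} (hβ : 0 ≤ β)
    (hdom : ∀ x x', ∀ p ∈ M.unc x (π x), M.discount * (p (Sum.inl x')).toReal ≤ β * P x x')
    (u v : X → ℝ) : weightedNorm d (robustBellman M π u - robustBellman M π v) ≤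
      β * weightedNorm d (u - v) := by
  refine weightedNorm_le_of_abs_le hd hP0 hP1 hdP hβ fun x => ?_
  have h := abs_discount_mul_sigma_sub_le (M.unc_nonempty x (π x)) M.discount_nonneg
    (fun p hp x' => hdom x x' p hp) u v
  simpa [robustBellman, Finset.mul_sum, mul_assoc] using h

theorem exists_projected_fixedPoint (M : RobustMDP X Z U) (π : X → U) {d : X → ℝ}
    (hd : ∀ x, 0 < d x) {Φ : Matrix X (Fin K) ℝ} (hΦ : LinearIndependent ℝ Φ.col) {β : ℝ}
    (hβ0 : 0 ≤ β) (hβ1 : β < 1)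
    (hT : ∀ u v, weightedNorm d (robustBellman M π u - robustBellman M π v) ≤
      β * weightedNorm d (u - v)) :
    ∃ wstar : Fin K → ℝ,
      ∀ V : X → ℝ, V = weightedProj d Φ (robustBellman M π V) ↔ V = Φ.mulVec wstar := by
  simp only [weightedProj_eq_mulVec_leastSquares hΦ hd]
  set F : (X → ℝ) → (X → ℝ) := fun V => Φ.mulVec (leastSquares Φ d (robustBellman M π V)) with hF
  have hFc : ∀ u v, weightedNorm d (F u - F v) ≤ β * weightedNorm d (u - v) := by
    intro u v
    rw [hF]
    dsimp only
    rw [← Matrix.mulVec_sub, ← leastSquares_sub]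
    exact (weightedNorm_mulVec_leastSquares_le hΦ hd _).trans (hT u v)
  -- The inverse of `scaleMap d`: Banach's theorem is applied in Euclidean coordinates, where the
  -- weighted norm is the norm of a complete space.
  set t : EuclideanSpace ℝ X → X → ℝ := fun y x => y x / Real.sqrt (d x) with ht
  have hst : ∀ y, scaleMap d (t y) = y := by
    intro y
    ext x
    have := (Real.sqrt_pos.2 (hd x)).ne'
    simp only [scaleMap, ht, LinearMap.coe_mk, AddHom.coe_mk]
    field_simp
  have hcontr : ContractingWith ⟨β, hβ0⟩ (fun y => scaleMap d (F (t y))) := by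
    refine ⟨by exact_mod_cast hβ1, LipschitzWith.of_dist_le_mul fun y z => ?_⟩
    have h := hFc (t y) (t z)
    rw [← norm_scaleMap d hd, ← norm_scaleMap d hd, map_sub, map_sub, hst, hst] at h
    rw [dist_eq_norm, dist_eq_norm]
    exact h
  set y := hcontr.fixedPoint
  have hy : scaleMap d (F (t y)) = y := hcontr.fixedPoint_isFixedPt
  have hzero : ∀ u v, scaleMap d u = scaleMap d v → u = v := by
    intro u v h
    rw [← sub_eq_zero, ← map_sub, ← norm_eq_zero, norm_scaleMap d hd] at h
    exact sub_eq_zero.1 (weightedNorm_eq_zero hd h)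
  have hfix : F (t y) = t y := hzero _ _ (by rw [hy, hst])
  refine ⟨leastSquares Φ d (robustBellman M π (t y)), fun V => ?_⟩
  change V = F V ↔ V = F (t y)
  constructor
  · intro hV
    have h := hFc V (t y)
    rw [← hV, hfix] at h
    have h0 : weightedNorm d (V - t y) = 0 := by
      have := weightedNorm_nonneg d (V - t y)
      nlinarith
    rw [hfix]
    exact sub_eq_zero.1 (weightedNorm_eq_zero hd h0)
  · rintro rfl
    rw [hfix, hfix]

theorem tendsto_sampledRPVI (M : RobustMDP X Z U) (π : X → U) {d : X → ℝ}
    (hd : ∀ x, 0 < d x) {Φ : Matrix X (Fin K) ℝ} (hΦ : LinearIndependent ℝ Φ.col) {β : ℝ}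
    (hβ0 : 0 ≤ β) (hβ1 : β < 1)
    (hT : ∀ u v, weightedNorm d (robustBellman M π u - robustBellman M π v) ≤
      β * weightedNorm d (u - v)) {wstar : Fin K → ℝ}
    (hw : Φ.mulVec wstar = weightedProj d Φ (robustBellman M π (Φ.mulVec wstar)))
    {c : ℕ → X → ℝ} (hc : Tendsto c atTop (𝓝 d)) (w₀ : Fin K → ℝ) :
    Tendsto (fun q : ℕ × ℕ => sampledRPVI M π Φ (fun f => ∑ x, c q.1 x * f x) w₀ q.2)
      (atTop ×ˢ atTop) (𝓝 wstar) := by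
  rw [weightedProj_eq_mulVec_leastSquares hΦ hd] at hw
  set w : ℕ → ℕ → Fin K → ℝ := fun N k => sampledRPVI M π Φ (fun f => ∑ x, c N x * f x) w₀ k
    with hwdef
  set T := robustBellman M π
  set ε : ℕ → ℝ := fun N => Real.sqrt (∑ x, ∑ y, d x *
    ((fitMatrix Φ (c N) - fitMatrix Φ d) x y ^ 2 / d y)) with hε
  have hlimM : Tendsto (fun N => fitMatrix Φ (c N)) atTop (𝓝 (fitMatrix Φ d)) :=
    (continuousAt_fitMatrix (isUnit_det_weightedGram hΦ hd)).tendsto.comp hc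
  have hεlim : Tendsto ε atTop (𝓝 0) := by
    have hcont : Continuous fun A : Matrix X X ℝ => Real.sqrt (∑ x, ∑ y, d x *
        ((A - fitMatrix Φ d) x y ^ 2 / d y)) := by
      simp only [Matrix.sub_apply]
      refine Real.continuous_sqrt.comp (continuous_finsetSum _ fun x _ =>
        continuous_finsetSum _ fun y _ => continuous_const.mul (Continuous.div_const
          (((continuous_id.matrix_elem x y).sub continuous_const).pow 2) _))
    have := (hcont.tendsto (fitMatrix Φ d)).comp hlimM
    simpa [hε, Function.comp_def] using this
  have hlim : Tendsto (fun q : ℕ × ℕ => weightedNorm d (Φ.mulVec (w q.1 q.2) - Φ.mulVec wstar))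
      (atTop ×ˢ atTop) (𝓝 0) := by
    refine tendsto_zero_of_perturbed_contraction
      (e := fun N k => weightedNorm d (Φ.mulVec (w N k) - Φ.mulVec wstar))
      (C := weightedNorm d (T (Φ.mulVec wstar))) hβ0 hβ1
      (weightedNorm_nonneg _ _) (fun _ _ => weightedNorm_nonneg _ _)
      (C₀ := weightedNorm d (Φ.mulVec w₀ - Φ.mulVec wstar)) (fun N => le_of_eq (by
        simp only [hwdef, sampledRPVI]))
      (fun N => Real.sqrt_nonneg _) hεlim fun N k => ?_
    set v := Φ.mulVec (w N k) with hv
    have hstep : w N (k + 1) = leastSquares Φ (c N) (T v) := sampledRPVI_succ M π Φ (c N) w₀ k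
    -- The first summand is the exact projected update, which contracts. The second is the error of
    -- the fit; `h3` bounds the vector it acts on by a constant plus the current error.
    have hsplit : Φ.mulVec (w N (k + 1)) - Φ.mulVec wstar =
        Φ.mulVec (leastSquares Φ d (T v - T (Φ.mulVec wstar))) +
          (fitMatrix Φ (c N) - fitMatrix Φ d).mulVec (T v) := by
      rw [hstep, Matrix.sub_mulVec, fitMatrix_mulVec, fitMatrix_mulVec, leastSquares_sub,
        Matrix.mulVec_sub, ← hw]
      abel
    have h1 := weightedNorm_mulVec_leastSquares_le hΦ hd (T v - T (Φ.mulVec wstar))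
    have h2 := hT v (Φ.mulVec wstar)
    have h3 : weightedNorm d (T v) ≤ weightedNorm d (T (Φ.mulVec wstar)) +
        weightedNorm d (v - Φ.mulVec wstar) := by
      have h4 := weightedNorm_add_le hd (T (Φ.mulVec wstar)) (T v - T (Φ.mulVec wstar))
      rw [add_sub_cancel] at h4
      have h5 := mul_le_of_le_one_left (weightedNorm_nonneg d (v - Φ.mulVec wstar)) hβ1.le
      linarith
    rw [hsplit]
    refine (weightedNorm_add_le hd _ _).trans (add_le_add (h1.trans h2) ?_)
    exact (weightedNorm_mulVec_le hd _ _).trans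
      (mul_le_mul_of_nonneg_left h3 (Real.sqrt_nonneg _))
  -- The features are injective, so a linear left inverse, continuous in finite dimension, carries
  -- convergence of `Φ w` back to `w`.
  have hinj : LinearMap.ker ((scaleMap d).comp Φ.mulVecLin) = ⊥ := by
    rw [LinearMap.ker_eq_bot']
    intro a ha
    rw [LinearMap.comp_apply, Matrix.mulVecLin_apply, ← norm_eq_zero, norm_scaleMap d hd] at ha
    apply Matrix.mulVec_injective_iff.2 hΦ
    rw [weightedNorm_eq_zero hd ha, Matrix.mulVec_zero]
  obtain ⟨g, hg⟩ := LinearMap.exists_leftInverse_of_injective _ hinj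
  have hgc : Continuous g := g.continuous_of_finiteDimensional
  have hlim2 : Tendsto (fun q : ℕ × ℕ => scaleMap d (Φ.mulVec (w q.1 q.2))) (atTop ×ˢ atTop)
      (𝓝 (scaleMap d (Φ.mulVec wstar))) := by
    rw [tendsto_iff_norm_sub_tendsto_zero]
    simpa only [← map_sub, norm_scaleMap d hd] using hlim
  have hgl : ∀ a, g (scaleMap d (Φ.mulVec a)) = a := fun a => by
    simpa using LinearMap.congr_fun hg a
  simpa only [Function.comp_def, hgl] using (hgc.tendsto _).comp hlim2

end Deterministic

/-! ### Occupation probabilities and the Poisson equation. -/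

section ChainAlgebra

variable {X Z : Type*}

/-- The transition probabilities between non-terminal states. -/
noncomputable def transitionMatrix (Phat : X → PMF (X ⊕ Z)) : Matrix X X ℝ :=
  Matrix.of fun i j => (Phat i (Sum.inl j)).toReal

/-- The probability that the chain is in the non-terminal state `j` at time `t`. -/
noncomputable def occupation (Phat : X → PMF (X ⊕ Z)) (ν : PMF X) (t : ℕ) (j : X) : ℝ :=
  (chainLaw Phat ν t (Sum.inl j)).toReal

theorem transitionMatrix_nonneg (Phat : X → PMF (X ⊕ Z)) (i j : X) :
    0 ≤ transitionMatrix Phat i j := ENNReal.toReal_nonneg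

theorem occupation_nonneg (Phat : X → PMF (X ⊕ Z)) (ν : PMF X) (t : ℕ) (j : X) :
    0 ≤ occupation Phat ν t j := ENNReal.toReal_nonneg

theorem chainLaw_zero_inl (Phat : X → PMF (X ⊕ Z)) (ν : PMF X) (j : X) :
    chainLaw Phat ν 0 (Sum.inl j) = ν j := by
  classical
  rw [chainLaw, PMF.map_apply, tsum_eq_single j]
  · simp
  · intro i hi
    simp [hi.symm]

theorem occupation_zero (Phat : X → PMF (X ⊕ Z)) (ν : PMF X) (j : X) :
    occupation Phat ν 0 j = (ν j).toReal := by
  rw [occupation, chainLaw_zero_inl]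

theorem pos_of_hasSum_occupation {Phat : X → PMF (X ⊕ Z)} {ν : PMF X} {d : X → ℝ}
    (hd : ∀ j, HasSum (fun t => occupation Phat ν t j) (d j))
    (hv : ∀ j, ∃ t, 0 < chainLaw Phat ν t (Sum.inl j)) (j : X) : 0 < d j := by
  obtain ⟨t, ht⟩ := hv j
  refine lt_of_lt_of_le (ENNReal.toReal_pos ht.ne' (PMF.apply_ne_top _ _)) ?_
  exact le_hasSum (hd j) t fun s _ => occupation_nonneg _ _ _ _

variable [Fintype X]

theorem sum_inl_add_tsum_inr (p : PMF (X ⊕ Z)) :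
    ∑ j, p (Sum.inl j) + ∑' z, p (Sum.inr z) = 1 := by
  rw [← p.tsum_coe, Summable.tsum_sum ENNReal.summable ENNReal.summable,
    tsum_fintype (fun j => p (Sum.inl j))]

theorem sum_toReal_inl (p : PMF (X ⊕ Z)) :
    ∑ j, (p (Sum.inl j)).toReal = 1 - (∑' z, p (Sum.inr z)).toReal := by
  have h := sum_inl_add_tsum_inr p
  have hz : ∑' z, p (Sum.inr z) ≠ ⊤ :=
    ne_top_of_le_ne_top ENNReal.one_ne_top (h ▸ le_add_self)
  have hj : ∑ j, p (Sum.inl j) ≠ ⊤ :=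
    ne_top_of_le_ne_top ENNReal.one_ne_top (h ▸ le_self_add)
  rw [← ENNReal.toReal_sum fun j _ => p.apply_ne_top _, eq_sub_iff_add_eq,
    ← ENNReal.toReal_add hj hz, h, ENNReal.toReal_one]

theorem sum_toReal_inl_le_one (p : PMF (X ⊕ Z)) : ∑ j, (p (Sum.inl j)).toReal ≤ 1 := by
  rw [sum_toReal_inl]
  exact sub_le_self _ ENNReal.toReal_nonneg

theorem sum_toReal_inl_of_isEmpty [IsEmpty Z] (p : PMF (X ⊕ Z)) :
    ∑ j, (p (Sum.inl j)).toReal = 1 := by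
  rw [sum_toReal_inl, tsum_empty, ENNReal.toReal_zero, sub_zero]

theorem occupation_succ (Phat : X → PMF (X ⊕ Z)) (ν : PMF X) (t : ℕ) (j : X) :
    occupation Phat ν (t + 1) j = ∑ i, occupation Phat ν t i * transitionMatrix Phat i j := by
  rw [occupation, chainLaw, PMF.bind_apply, Summable.tsum_sum ENNReal.summable ENNReal.summable,
    tsum_fintype]
  have hz : ∀ z : Z, chainLaw Phat ν t (Sum.inr z) * step Phat (Sum.inr z) (Sum.inl j) = 0 := by
    intro z
    simp [step]
  simp only [hz, tsum_zero, add_zero]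
  rw [ENNReal.toReal_sum fun i _ => ENNReal.mul_ne_top (PMF.apply_ne_top _ _)
    (PMF.apply_ne_top _ _)]
  simp only [ENNReal.toReal_mul]
  rfl

theorem sum_occupation_succ_mul (Phat : X → PMF (X ⊕ Z)) (ν : PMF X) (t : ℕ) (f : X → ℝ) :
    ∑ j, occupation Phat ν (t + 1) j * f j =
      ∑ i, occupation Phat ν t i * ∑ j, transitionMatrix Phat i j * f j := by
  simp only [occupation_succ, Finset.sum_mul, Finset.mul_sum]
  rw [Finset.sum_comm]
  exact Finset.sum_congr rfl fun i _ => Finset.sum_congr rfl fun j _ => by ring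

theorem occupation_pure_zero (Phat : X → PMF (X ⊕ Z)) (i : X) (f : X → ℝ) :
    ∑ j, occupation Phat (PMF.pure i) 0 j * f j = f i := by
  classical
  rw [Finset.sum_eq_single i]
  · simp [occupation_zero]
  · intro j _ hj
    simp [occupation_zero, hj]
  · simp

/-- Chapman–Kolmogorov. Summing over non-terminal intermediate states suffices, because terminal
states are absorbing. -/
theorem occupation_add (Phat : X → PMF (X ⊕ Z)) (ν : PMF X) (t n : ℕ) (j : X) :
    occupation Phat ν (t + n) j =
      ∑ i, occupation Phat ν t i * occupation Phat (PMF.pure i) n j := by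
  classical
  induction n generalizing j with
  | zero =>
    rw [add_zero, Finset.sum_eq_single j]
    · simp [occupation_zero]
    · intro i _ hi
      simp [occupation_zero, hi.symm]
    · simp
  | succ n ih =>
    rw [← add_assoc, occupation_succ]
    simp only [ih, occupation_succ, Finset.sum_mul, Finset.mul_sum]
    rw [Finset.sum_comm]
    exact Finset.sum_congr rfl fun i _ => Finset.sum_congr rfl fun j _ => by ring

theorem sum_occupation_le_one (Phat : X → PMF (X ⊕ Z)) (ν : PMF X) (t : ℕ) :
    ∑ j, occupation Phat ν t j ≤ 1 := sum_toReal_inl_le_one _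

/-- By finiteness of `X`, the worst survival probability `ρ` over `n` steps is below one. Hence the
survival mass satisfies `q (n + t) ≤ ρ * q t`, and each partial sum `s` obeys `s ≤ n + ρ * s`. -/
theorem summable_occupation (Phat : X → PMF (X ⊕ Z)) (ν : PMF X) {n : ℕ}
    (hn : ∀ i, 0 < ∑' z : Z, chainLaw Phat (PMF.pure i) n (Sum.inr z)) (j : X) :
    Summable fun t => occupation Phat ν t j := by
  have hr : ∀ i, ∑ j, occupation Phat (PMF.pure i) n j < 1 := by
    intro i
    have h := sum_inl_add_tsum_inr (chainLaw Phat (PMF.pure i) n)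
    have hz : ∑' z, chainLaw Phat (PMF.pure i) n (Sum.inr z) ≠ ⊤ :=
      ne_top_of_le_ne_top ENNReal.one_ne_top (h ▸ le_add_self)
    simp only [occupation]
    rw [sum_toReal_inl]
    exact sub_lt_self _ (ENNReal.toReal_pos (hn i).ne' hz)
  have : Nonempty X := ⟨j⟩
  obtain ⟨i₀, hi₀⟩ := Finite.exists_max fun i => ∑ j, occupation Phat (PMF.pure i) n j
  set ρ := ∑ j, occupation Phat (PMF.pure i₀) n j
  set q : ℕ → ℝ := fun t => ∑ j, occupation Phat ν t j with hq
  have hq0 : ∀ t, 0 ≤ q t := fun t => Finset.sum_nonneg fun j _ => occupation_nonneg _ _ _ _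
  have hdecay : ∀ t, q (n + t) ≤ ρ * q t := by
    intro t
    simp only [hq]
    rw [add_comm]
    simp only [occupation_add Phat ν t n]
    rw [Finset.sum_comm, Finset.mul_sum]
    refine Finset.sum_le_sum fun i _ => ?_
    rw [← Finset.mul_sum, mul_comm]
    exact mul_le_mul_of_nonneg_right (hi₀ i) (occupation_nonneg _ _ _ _)
  have hsum : ∀ T, ∑ t ∈ Finset.range T, q t ≤ n / (1 - ρ) := by
    intro T
    rw [le_div_iff₀ (sub_pos.2 (hr i₀))]
    have h1 : ∑ t ∈ Finset.range T, q t ≤ ∑ t ∈ Finset.range (n + T), q t :=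
      Finset.sum_le_sum_of_subset_of_nonneg (Finset.range_subset_range.2 (Nat.le_add_left _ _))
        fun t _ _ => hq0 t
    rw [Finset.sum_range_add] at h1
    have h2 : ∑ t ∈ Finset.range n, q t ≤ n := by
      simpa using Finset.sum_le_sum fun t (_ : t ∈ Finset.range n) =>
        sum_occupation_le_one Phat ν t
    have h3 : ∑ t ∈ Finset.range T, q (n + t) ≤ ρ * ∑ t ∈ Finset.range T, q t := by
      rw [Finset.mul_sum]
      exact Finset.sum_le_sum fun t _ => hdecay t
    linarith
  exact Summable.of_nonneg_of_le (fun t => occupation_nonneg _ _ _ _)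
    (fun t => Finset.single_le_sum (f := fun j => occupation Phat ν t j)
      (fun j _ => occupation_nonneg _ _ _ _) (Finset.mem_univ j))
    (summable_of_sum_range_le hq0 hsum)

theorem hasSum_occupation {Phat : X → PMF (X ⊕ Z)} {ν : PMF X} {d : X → ℝ} {n : ℕ}
    (hn : ∀ i, 0 < ∑' z : Z, chainLaw Phat (PMF.pure i) n (Sum.inr z))
    (hd : ∀ j, d j = (∑' t, chainLaw Phat ν t (Sum.inl j)).toReal) (j : X) :
    HasSum (fun t => occupation Phat ν t j) (d j) := by
  rw [hd, ENNReal.tsum_toReal_eq fun t => PMF.apply_ne_top _ _]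
  exact (summable_occupation Phat ν hn j).hasSum

theorem sum_mul_transitionMatrix_le_of_hasSum {Phat : X → PMF (X ⊕ Z)} {ν : PMF X} {d : X → ℝ}
    (hd : ∀ j, HasSum (fun t => occupation Phat ν t j) (d j)) (j : X) :
    ∑ i, d i * transitionMatrix Phat i j ≤ d j := by
  have h1 : HasSum (fun t => occupation Phat ν (t + 1) j)
      (∑ i, d i * transitionMatrix Phat i j) := by
    simp only [occupation_succ]
    exact hasSum_sum fun i _ => (hd i).mul_right _
  have h2 := (hasSum_nat_add_iff' 1).2 (hd j)
  rw [h1.unique h2]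
  simpa using occupation_nonneg Phat ν 0 j

theorem sum_mul_transitionMatrix_eq_of_tendsto {Phat : X → PMF (X ⊕ Z)} {d : X → ℝ}
    (hd : ∀ i j, Tendsto (fun t => occupation Phat (PMF.pure i) t j) atTop (𝓝 (d j))) (j : X) :
    ∑ i, d i * transitionMatrix Phat i j = d j := by
  refine tendsto_nhds_unique ?_ ((tendsto_add_atTop_iff_nat 1).2 (hd j j))
  simp only [occupation_succ]
  exact tendsto_finsetSum _ fun i _ => (hd j i).mul_const _

/-- The expectation of a harmonic `v` at time `t` does not depend on `t`, and its limit does not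
depend on the initial state. -/
theorem eq_of_harmonic {Phat : X → PMF (X ⊕ Z)} {d : X → ℝ}
    (hd : ∀ i j, Tendsto (fun t => occupation Phat (PMF.pure i) t j) atTop (𝓝 (d j))) {v : X → ℝ}
    (hv : ∀ i, ∑ j, transitionMatrix Phat i j * v j = v i) (i : X) : v i = ∑ j, d j * v j := by
  have h : ∀ t, ∑ j, occupation Phat (PMF.pure i) t j * v j = v i := by
    intro t
    induction t with
    | zero => exact occupation_pure_zero Phat i v
    | succ t ih => rw [sum_occupation_succ_mul, ← ih]; simp only [hv]
  have hl : Tendsto (fun t => ∑ j, occupation Phat (PMF.pure i) t j * v j) atTop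
      (𝓝 (∑ j, d j * v j)) := tendsto_finsetSum _ fun j _ => (hd i j).mul_const _
  simp only [h] at hl
  exact tendsto_nhds_unique tendsto_const_nhds hl

theorem sum_eq_one_of_tendsto [IsEmpty Z] [Nonempty X] {Phat : X → PMF (X ⊕ Z)} {d : X → ℝ}
    (hd : ∀ i j, Tendsto (fun t => occupation Phat (PMF.pure i) t j) atTop (𝓝 (d j))) :
    ∑ j, d j = 1 := by
  obtain ⟨i⟩ := ‹Nonempty X›
  refine tendsto_nhds_unique (tendsto_finsetSum _ fun j _ => hd i j) ?_
  simp only [occupation, sum_toReal_inl_of_isEmpty]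
  exact tendsto_const_nhds

/-- Solvability of the Poisson equation for functions with mean zero. -/
theorem exists_poisson [IsEmpty Z] [Nonempty X] {Phat : X → PMF (X ⊕ Z)} {d : X → ℝ}
    (hd : ∀ i j, Tendsto (fun t => occupation Phat (PMF.pure i) t j) atTop (𝓝 (d j)))
    {f : X → ℝ} (hf : ∑ j, d j * f j = 0) :
    ∃ g : X → ℝ, ∀ i, g i - ∑ j, transitionMatrix Phat i j * g j = f i := by
  have hd1 := sum_eq_one_of_tendsto hd
  have hdP : ∀ v : X → ℝ, ∑ i, d i * ∑ j, transitionMatrix Phat i j * v j = ∑ j, d j * v j := by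
    intro v
    simp only [Finset.mul_sum]
    rw [Finset.sum_comm]
    refine Finset.sum_congr rfl fun j _ => ?_
    rw [← sum_mul_transitionMatrix_eq_of_tendsto hd j, Finset.sum_mul]
    exact Finset.sum_congr rfl fun i _ => by ring
  -- `L = 1 - P` plus the rank-one map to the `d`-mean. It preserves the `d`-mean, so its kernel
  -- consists of harmonic functions of mean zero, which vanish. Thus `L` is onto, and a preimage of
  -- a mean-zero `f` has mean zero and solves the Poisson equation.
  let L : (X → ℝ) →ₗ[ℝ] (X → ℝ) :=
    { toFun := fun v i => v i - ∑ j, transitionMatrix Phat i j * v j + ∑ j, d j * v j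
      map_add' := fun u v => by
        funext i
        simp only [Pi.add_apply, mul_add, Finset.sum_add_distrib]
        ring
      map_smul' := fun c v => by
        funext i
        simp only [Pi.smul_apply, smul_eq_mul, RingHom.id_apply, mul_add, mul_sub, Finset.mul_sum,
          mul_left_comm] }
  have hmean : ∀ v, ∑ i, d i * L v i = ∑ j, d j * v j := by
    intro v
    simp only [L, LinearMap.coe_mk, AddHom.coe_mk, mul_add, mul_sub, Finset.sum_add_distrib,
      Finset.sum_sub_distrib, hdP]
    rw [← Finset.sum_mul, hd1]
    ring
  have hinj : Function.Injective L := by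
    refine (injective_iff_map_eq_zero L).2 fun v hv => ?_
    have h0 : ∑ j, d j * v j = 0 := by
      rw [← hmean, hv]
      simp
    have hh : ∀ i, ∑ j, transitionMatrix Phat i j * v j = v i := by
      intro i
      have := congrFun hv i
      simp only [L, LinearMap.coe_mk, AddHom.coe_mk, h0, Pi.zero_apply] at this
      linarith
    funext i
    rw [eq_of_harmonic hd hh i, h0, Pi.zero_apply]
  obtain ⟨g, hg⟩ := LinearMap.injective_iff_surjective.1 hinj f
  have h0 : ∑ j, d j * g j = 0 := by rw [← hmean, hg, hf]
  refine ⟨g, fun i => ?_⟩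
  have := congrFun hg i
  simp only [L, LinearMap.coe_mk, AddHom.coe_mk, h0] at this
  linarith

end ChainAlgebra

/-! ### Probabilities of finite paths. -/

section PathProbability

variable {X Z Ω : Type*} [MeasurableSpace Ω]

/-- The probability that the chain starts with the non-terminal states `a 0, …, a n`. -/
noncomputable def pathProb (Phat : X → PMF (X ⊕ Z)) (ν : PMF X) (n : ℕ) (a : Fin (n + 1) → X) : ℝ :=
  (ν (a 0)).toReal * ∏ t : Fin n, transitionMatrix Phat (a t.castSucc) (a t.succ)

theorem pathProb_nonneg (Phat : X → PMF (X ⊕ Z)) (ν : PMF X) (n : ℕ) (a : Fin (n + 1) → X) :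
    0 ≤ pathProb Phat ν n a :=
  mul_nonneg ENNReal.toReal_nonneg (Finset.prod_nonneg fun _ _ => transitionMatrix_nonneg _ _ _)

theorem pathProb_snoc (Phat : X → PMF (X ⊕ Z)) (ν : PMF X) (n : ℕ) (a : Fin (n + 1) → X) (b : X) :
    pathProb Phat ν (n + 1) (Fin.snoc a b) =
      pathProb Phat ν n a * transitionMatrix Phat (a (Fin.last n)) b := by
  have h0 : (Fin.snoc a b : Fin (n + 2) → X) 0 = a 0 := by
    rw [← Fin.castSucc_zero, Fin.snoc_castSucc (α := fun _ => X)]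
  simp only [pathProb]
  rw [Fin.prod_univ_castSucc, h0, mul_assoc]
  congr 2
  · refine Finset.prod_congr rfl fun t _ => ?_
    rw [Fin.succ_castSucc, Fin.snoc_castSucc (α := fun _ => X),
      Fin.snoc_castSucc (α := fun _ => X)]
  · rw [Fin.succ_last, Fin.snoc_last (α := fun _ => X), Fin.snoc_castSucc (α := fun _ => X)]

theorem measureReal_prefix {μ : Measure Ω} {Phat : X → PMF (X ⊕ Z)} {ν : PMF X}
    {ξ : ℕ → Ω → X ⊕ Z} (h : IsTrajectory μ Phat ν ξ) (n : ℕ) (a : Fin (n + 1) → X) :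
    μ.real {ω | ∀ t : Fin (n + 1), ξ t ω = Sum.inl (a t)} = pathProb Phat ν n a := by
  -- The path is extended to all of `ℕ` by reduction modulo `n + 1`; values beyond `n` are
  -- irrelevant.
  have hlaw := h.law n fun t => Sum.inl (a (Fin.ofNat (n + 1) t))
  have hset : {ω | ∀ t ≤ n, ξ t ω = Sum.inl (a (Fin.ofNat (n + 1) t))} =
      {ω | ∀ t : Fin (n + 1), ξ t ω = Sum.inl (a t)} := by
    ext ω
    constructor
    · intro hω t
      simpa using hω t (Nat.lt_succ_iff.1 t.2)
    · intro hω t ht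
      have := hω (Fin.ofNat (n + 1) t)
      rwa [Fin.val_ofNat, Nat.mod_eq_of_lt (Nat.lt_succ_of_le ht)] at this
  rw [hset] at hlaw
  rw [Measure.real, hlaw, ENNReal.toReal_mul, ENNReal.toReal_prod, chainLaw_zero_inl, pathProb,
    Finset.prod_range]
  congr 1
  refine Finset.prod_congr rfl fun t _ => ?_
  have h1 : Fin.ofNat (n + 1) (t : ℕ) = t.castSucc := by
    ext
    simp
  have h2 : Fin.ofNat (n + 1) ((t : ℕ) + 1) = t.succ := by
    ext
    simp [Nat.mod_eq_of_lt (Nat.succ_lt_succ t.2)]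
  rw [h1, h2]
  rfl

theorem measurableSet_trajectory_eq {μ : Measure Ω} {Phat : X → PMF (X ⊕ Z)} {ν : PMF X}
    {ξ : ℕ → Ω → X ⊕ Z} (h : IsTrajectory μ Phat ν ξ) (t : ℕ) (c : X ⊕ Z) :
    MeasurableSet {ω | ξ t ω = c} :=
  h.measurable t (MeasurableSpace.measurableSet_top (s := {c}))

theorem measurableSet_prefix {μ : Measure Ω} {Phat : X → PMF (X ⊕ Z)} {ν : PMF X}
    {ξ : ℕ → Ω → X ⊕ Z} (h : IsTrajectory μ Phat ν ξ) (n : ℕ) (a : Fin (n + 1) → X) :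
    MeasurableSet {ω | ∀ t : Fin (n + 1), ξ t ω = Sum.inl (a t)} := by
  rw [Set.ofPred_forall]
  exact MeasurableSet.iInter fun t => measurableSet_trajectory_eq h t _

variable [Fintype X]

theorem sum_fin_succ_eq_sum_snoc {n : ℕ} (F : (Fin (n + 1) → X) → ℝ) :
    ∑ a, F a = ∑ a : Fin n → X, ∑ b, F (Fin.snoc a b) := by
  classical
  rw [← (Fin.snocEquiv fun _ : Fin (n + 1) => X).sum_comp, Fintype.sum_prod_type_right]
  rfl

theorem sum_pathProb_mul (Phat : X → PMF (X ⊕ Z)) (ν : PMF X) (n : ℕ) (f : X → ℝ) :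
    ∑ a, pathProb Phat ν n a * f (a (Fin.last n)) = ∑ j, occupation Phat ν n j * f j := by
  induction n generalizing f with
  | zero =>
    rw [← (Equiv.funUnique (Fin 1) X).symm.sum_comp]
    refine Finset.sum_congr rfl fun j _ => ?_
    simp [pathProb, occupation_zero]
  | succ n ih =>
    rw [sum_fin_succ_eq_sum_snoc, sum_occupation_succ_mul, ← ih]
    refine Finset.sum_congr rfl fun a _ => ?_
    rw [Finset.mul_sum]
    refine Finset.sum_congr rfl fun b _ => ?_
    rw [pathProb_snoc, Fin.snoc_last (α := fun _ => X), mul_assoc]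

end PathProbability

/-! ### The ergodic theorem along one trajectory. -/

section ErgodicAverage

/-- By Tonelli the sum of the `W k` has finite integral, so it is finite almost everywhere and its
terms tend to zero. -/
theorem ae_tendsto_zero_of_summable_integral {Ω : Type*} [MeasurableSpace Ω] {μ : Measure Ω}
    {W : ℕ → Ω → ℝ} (hW : ∀ k, Integrable (W k) μ) (hW0 : ∀ k ω, 0 ≤ W k ω)
    (hs : Summable fun k => ∫ ω, W k ω ∂μ) :
    ∀ᵐ ω ∂μ, Tendsto (fun k => W k ω) atTop (𝓝 0) := by
  have hlt : ∑' k, ∫⁻ ω, ENNReal.ofReal (W k ω) ∂μ ≠ ⊤ := by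
    have heq : ∀ k, ∫⁻ ω, ENNReal.ofReal (W k ω) ∂μ = ENNReal.ofReal (∫ ω, W k ω ∂μ) := fun k =>
      (ofReal_integral_eq_lintegral_ofReal (hW k) (Eventually.of_forall (hW0 k))).symm
    simp only [heq]
    exact hs.tsum_ofReal_ne_top
  have hm : ∀ k, AEMeasurable (fun ω => ENNReal.ofReal (W k ω)) μ := fun k =>
    (hW k).aestronglyMeasurable.aemeasurable.ennreal_ofReal
  rw [← lintegral_tsum hm] at hlt
  filter_upwards [ae_lt_top' (AEMeasurable.tsum hm) hlt] with ω hω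
  have h := ENNReal.tendsto_atTop_zero_of_tsum_ne_top hω.ne
  have h2 := (ENNReal.tendsto_toReal ENNReal.zero_ne_top).comp h
  simpa [Function.comp_def, ENNReal.toReal_ofReal (hW0 _ _)] using h2

/-- A sequence with bounded increments is sublinear as soon as it is so along the squares. -/
theorem tendsto_div_of_tendsto_div_sq {s : ℕ → ℝ} {B : ℝ} (hB : ∀ n, |s (n + 1) - s n| ≤ B)
    (hs : Tendsto (fun k : ℕ => s (k ^ 2) / (k : ℝ) ^ 2) atTop (𝓝 0)) :
    Tendsto (fun n : ℕ => s n / n) atTop (𝓝 0) := by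
  have hB0 : 0 ≤ B := (abs_nonneg _).trans (hB 0)
  have hinc : ∀ m j, |s (m + j) - s m| ≤ j * B := by
    intro m j
    induction j with
    | zero => simp
    | succ j ih =>
      have h1 := hB (m + j)
      have h2 := abs_sub_le (s (m + j + 1)) (s (m + j)) (s m)
      rw [← add_assoc]
      push_cast
      linarith
  have hsqrt : Tendsto Nat.sqrt atTop atTop := by
    refine tendsto_atTop.2 fun b => ?_
    filter_upwards [eventually_ge_atTop (b * b)] with n hn
    exact Nat.le_sqrt.2 hn
  have hu : Tendsto (fun k : ℕ => |s (k ^ 2) / (k : ℝ) ^ 2| + 2 * B / k) atTop (𝓝 0) := by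
    simpa using hs.abs.add (tendsto_const_div_atTop_nhds_zero_nat (2 * B))
  refine squeeze_zero_norm' ?_ (hu.comp hsqrt)
  filter_upwards [eventually_ge_atTop 1] with n hn
  simp only [Function.comp_apply]
  set k := Nat.sqrt n with hk
  have hk1 : 1 ≤ k := Nat.le_sqrt.2 (by simpa using hn)
  have hkn : k ^ 2 ≤ n := by rw [sq]; exact Nat.sqrt_le n
  -- From `n < (k + 1) ^ 2`: at most `2 * k` increments separate `n` from the preceding square, and
  -- these are negligible against `k ^ 2`.
  have hnk : n ≤ k ^ 2 + 2 * k := by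
    have := Nat.sqrt_le_add n
    rw [← hk] at this
    nlinarith
  clear_value k
  obtain ⟨j, rfl⟩ := Nat.exists_eq_add_of_le hkn
  have hj : (j : ℝ) ≤ 2 * k := by exact_mod_cast (by omega : j ≤ 2 * k)
  have hkpos : (0 : ℝ) < k := by exact_mod_cast hk1
  have h1 : |s (k ^ 2 + j)| ≤ |s (k ^ 2)| + 2 * k * B := by
    have h2 := hinc (k ^ 2) j
    have h3 := abs_sub_abs_le_abs_sub (s (k ^ 2 + j)) (s (k ^ 2))
    have h4 := mul_le_mul_of_nonneg_right hj hB0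
    linarith
  have hle : (k : ℝ) ^ 2 ≤ ((k ^ 2 + j : ℕ) : ℝ) := by exact_mod_cast hkn
  rw [Real.norm_eq_abs, abs_div, Nat.abs_cast]
  have hsq : (0 : ℝ) < (k : ℝ) ^ 2 := by positivity
  calc |s (k ^ 2 + j)| / ((k ^ 2 + j : ℕ) : ℝ) ≤ (|s (k ^ 2)| + 2 * k * B) / (k : ℝ) ^ 2 :=
        div_le_div₀ (by positivity) h1 hsq hle
    _ = |s (k ^ 2) / (k : ℝ) ^ 2| + 2 * B / k := by
        rw [abs_div, abs_of_pos hsq]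
        field_simp

variable {X Z Ω : Type*} [MeasurableSpace Ω] [Fintype X]

/-- Expectations of prefixes become finite sums over paths, so the martingale estimate below is
finite algebra without conditional expectations. -/
theorem integral_prefix [IsEmpty Z] {μ : Measure Ω} [IsProbabilityMeasure μ]
    {Phat : X → PMF (X ⊕ Z)} {ν : PMF X} {ξ : ℕ → Ω → X ⊕ Z} (h : IsTrajectory μ Phat ν ξ)
    {y : ℕ → Ω → X} (hy : ∀ t ω, ξ t ω = Sum.inl (y t ω)) (n : ℕ) (F : (Fin (n + 1) → X) → ℝ) :
    Integrable (fun ω => F fun t => y t ω) μ ∧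
      ∫ ω, F (fun t => y t ω) ∂μ = ∑ a, pathProb Phat ν n a * F a := by
  let _ : MeasurableSpace (Fin (n + 1) → X) := ⊤
  have hpre : ∀ a : Fin (n + 1) → X, (fun ω (t : Fin (n + 1)) => y t ω) ⁻¹' {a} =
      {ω | ∀ t : Fin (n + 1), ξ t ω = Sum.inl (a t)} := by
    intro a
    ext ω
    simp [funext_iff, hy]
  have hm : Measurable (fun ω (t : Fin (n + 1)) => y t ω) := by
    refine measurable_to_countable' fun a => ?_
    rw [hpre]
    exact measurableSet_prefix h n a
  have := Measure.isProbabilityMeasure_map (μ := μ) hm.aemeasurable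
  have hF : Integrable F (μ.map fun ω (t : Fin (n + 1)) => y t ω) := Integrable.of_finite
  refine ⟨hF.comp_measurable hm, ?_⟩
  rw [← integral_map hm.aemeasurable hF.aestronglyMeasurable, integral_fintype hF]
  refine Finset.sum_congr rfl fun a _ => ?_
  rw [map_measureReal_apply hm (MeasurableSet.singleton a), hpre, measureReal_prefix h, smul_eq_mul]

/-- The sum of the martingale differences `g (a (t + 1)) - (P g) (a t)` along a path. -/
noncomputable def martingaleSum (Phat : X → PMF (X ⊕ Z)) (g : X → ℝ) (n : ℕ)
    (a : Fin (n + 1) → X) : ℝ :=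
  ∑ t : Fin n, (g (a t.succ) - ∑ j, transitionMatrix Phat (a t.castSucc) j * g j)

theorem martingaleSum_snoc (Phat : X → PMF (X ⊕ Z)) (g : X → ℝ) (n : ℕ) (a : Fin (n + 1) → X)
    (b : X) : martingaleSum Phat g (n + 1) (Fin.snoc a b) = martingaleSum Phat g n a +
      (g b - ∑ j, transitionMatrix Phat (a (Fin.last n)) j * g j) := by
  simp only [martingaleSum]
  rw [Fin.sum_univ_castSucc]
  congr 1
  · refine Finset.sum_congr rfl fun t _ => ?_
    rw [Fin.succ_castSucc, Fin.snoc_castSucc (α := fun _ => X),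
      Fin.snoc_castSucc (α := fun _ => X)]
  · rw [Fin.succ_last, Fin.snoc_last (α := fun _ => X), Fin.snoc_castSucc (α := fun _ => X)]

theorem sum_transitionMatrix_eq_one [IsEmpty Z] (Phat : X → PMF (X ⊕ Z)) (i : X) :
    ∑ j, transitionMatrix Phat i j = 1 := sum_toReal_inl_of_isEmpty (Phat i)

/-- Orthogonality of increments: given the path so far, the next increment has mean zero, which
kills the cross term, and its second moment is at most `B ^ 2`. -/
theorem sum_pathProb_mul_martingaleSum_sq_le [IsEmpty Z] (Phat : X → PMF (X ⊕ Z)) (ν : PMF X)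
    {g : X → ℝ} {B : ℝ} (hB : ∀ i b, |g b - ∑ j, transitionMatrix Phat i j * g j| ≤ B) (n : ℕ) :
    ∑ a, pathProb Phat ν n a * martingaleSum Phat g n a ^ 2 ≤ n * B ^ 2 := by
  induction n with
  | zero => simp [martingaleSum]
  | succ n ih =>
    have hmass : ∑ a, pathProb Phat ν n a ≤ 1 := by
      have := sum_pathProb_mul Phat ν n fun _ => 1
      simp only [mul_one] at this
      rw [this]
      exact sum_occupation_le_one Phat ν n
    have hstep : ∀ a : Fin (n + 1) → X, ∑ b, pathProb Phat ν (n + 1) (Fin.snoc a b) *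
        martingaleSum Phat g (n + 1) (Fin.snoc a b) ^ 2 ≤
        pathProb Phat ν n a * martingaleSum Phat g n a ^ 2 + pathProb Phat ν n a * B ^ 2 := by
      intro a
      simp only [pathProb_snoc, martingaleSum_snoc]
      set i := a (Fin.last n)
      set m := martingaleSum Phat g n a
      set e := ∑ j, transitionMatrix Phat i j * g j with he
      have h1 := sum_transitionMatrix_eq_one Phat i
      have hcentered : ∑ b, transitionMatrix Phat i b * (g b - e) = 0 := by
        simp only [mul_sub, Finset.sum_sub_distrib]
        rw [← Finset.sum_mul, h1, ← he, one_mul, sub_self]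
      have hsq : ∑ b, transitionMatrix Phat i b * (g b - e) ^ 2 ≤ B ^ 2 := by
        calc _ ≤ ∑ b, transitionMatrix Phat i b * B ^ 2 :=
              Finset.sum_le_sum fun b _ => mul_le_mul_of_nonneg_left
                (sq_le_sq' (abs_le.1 (hB i b)).1 (abs_le.1 (hB i b)).2)
                (transitionMatrix_nonneg _ _ _)
          _ = B ^ 2 := by rw [← Finset.sum_mul, h1, one_mul]
      have hexp : ∑ b, transitionMatrix Phat i b * (m + (g b - e)) ^ 2 =
          m ^ 2 + ∑ b, transitionMatrix Phat i b * (g b - e) ^ 2 := by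
        have : ∀ b, transitionMatrix Phat i b * (m + (g b - e)) ^ 2 =
            transitionMatrix Phat i b * m ^ 2 + 2 * m * (transitionMatrix Phat i b * (g b - e)) +
              transitionMatrix Phat i b * (g b - e) ^ 2 := fun b => by ring
        simp only [this, Finset.sum_add_distrib]
        rw [← Finset.sum_mul, ← Finset.mul_sum, h1, hcentered]
        ring
      simp only [mul_assoc]
      rw [← Finset.mul_sum, hexp, ← mul_add]
      exact mul_le_mul_of_nonneg_left (by linarith) (pathProb_nonneg _ _ _ _)
    rw [sum_fin_succ_eq_sum_snoc]
    refine (Finset.sum_le_sum fun a _ => hstep a).trans ?_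
    rw [Finset.sum_add_distrib, ← Finset.sum_mul]
    have := mul_le_mul_of_nonneg_right hmass (sq_nonneg B)
    push_cast
    linarith

theorem ae_tendsto_average_of_centered [IsEmpty Z] {μ : Measure Ω} [IsProbabilityMeasure μ]
    {Phat : X → PMF (X ⊕ Z)} {ν : PMF X} {ξ : ℕ → Ω → X ⊕ Z} (h : IsTrajectory μ Phat ν ξ)
    {y : ℕ → Ω → X} (hy : ∀ t ω, ξ t ω = Sum.inl (y t ω)) {d : X → ℝ}
    (hd : ∀ i j, Tendsto (fun t => occupation Phat (PMF.pure i) t j) atTop (𝓝 (d j)))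
    {f : X → ℝ} (hf : ∑ j, d j * f j = 0) :
    ∀ᵐ ω ∂μ, Tendsto (fun N : ℕ => (∑ t ∈ Finset.range N, f (y t ω)) / N) atTop (𝓝 0) := by
  have hX : Nonempty X := ν.support_nonempty.to_type
  obtain ⟨g, hg⟩ := exists_poisson hd hf
  obtain ⟨i₀, hi₀⟩ := Finite.exists_max fun q : X × X =>
    |g q.2 - ∑ j, transitionMatrix Phat q.1 j * g j|
  obtain ⟨j₀, hj₀⟩ := Finite.exists_max fun q : X × X => |g q.1 - g q.2|
  set B := |g i₀.2 - ∑ j, transitionMatrix Phat i₀.1 j * g j|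
  have hB : ∀ i b, |g b - ∑ j, transitionMatrix Phat i j * g j| ≤ B := fun i b => hi₀ (i, b)
  set M : ℕ → Ω → ℝ := fun n ω => martingaleSum Phat g n fun t => y t ω with hM
  have hMsum : ∀ n ω, M n ω =
      ∑ t ∈ Finset.range n, (g (y (t + 1) ω) - ∑ j, transitionMatrix Phat (y t ω) j * g j) := by
    intro n ω
    rw [Finset.sum_range]
    rfl
  have hint := fun n => integral_prefix h hy n fun a => martingaleSum Phat g n a ^ 2
  -- At `n = k ^ 2` the second moment of `M n / n` is at most `B ^ 2 / k ^ 2`, which is summable.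
  have hW : ∀ᵐ ω ∂μ, Tendsto (fun k : ℕ => (M (k ^ 2) ω / (k : ℝ) ^ 2) ^ 2) atTop (𝓝 0) := by
    refine ae_tendsto_zero_of_summable_integral (fun k => ?_) (fun k ω => sq_nonneg _) ?_
    · simp only [div_pow]
      exact (hint (k ^ 2)).1.div_const _
    · have hs : Summable fun k : ℕ => B ^ 2 * (1 / (k : ℝ) ^ 2) :=
        (Real.summable_one_div_nat_pow.2 one_lt_two).mul_left _
      refine Summable.of_nonneg_of_le (fun k => integral_nonneg fun ω => sq_nonneg _)
        (fun k => ?_) hs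
      simp only [div_pow]
      rw [integral_div, (hint (k ^ 2)).2]
      have hle := sum_pathProb_mul_martingaleSum_sq_le Phat ν hB (k ^ 2)
      rcases Nat.eq_zero_or_pos k with rfl | hk
      · simp
      · have hk' : (0 : ℝ) < (k : ℝ) ^ 2 := by positivity
        rw [div_le_iff₀ (by positivity)]
        refine hle.trans (le_of_eq ?_)
        push_cast
        field_simp
  filter_upwards [hW] with ω hω
  have hroot : Tendsto (fun k : ℕ => M (k ^ 2) ω / (k : ℝ) ^ 2) atTop (𝓝 0) := by
    have := (Real.continuous_sqrt.tendsto 0).comp hω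
    simp only [Function.comp_def, Real.sqrt_sq_eq_abs, Real.sqrt_zero] at this
    exact (tendsto_zero_iff_abs_tendsto_zero _).2 this
  have hMN := tendsto_div_of_tendsto_div_sq (s := fun n => M n ω) (B := B) (fun n => by
    rw [hMsum, hMsum, Finset.sum_range_succ, add_sub_cancel_left]
    exact hB _ _) hroot
  have hrest : Tendsto (fun N : ℕ => (g (y 0 ω) - g (y N ω)) / N) atTop (𝓝 0) := by
    refine squeeze_zero_norm (fun N => ?_)
      (tendsto_const_div_atTop_nhds_zero_nat |g j₀.1 - g j₀.2|)
    rw [Real.norm_eq_abs, abs_div, Nat.abs_cast]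
    exact div_le_div_of_nonneg_right (hj₀ (y 0 ω, y N ω)) (Nat.cast_nonneg _)
  have hsum := hMN.add hrest
  rw [add_zero] at hsum
  refine hsum.congr fun N => ?_
  rw [← add_div, hMsum]
  congr 1
  have htel := Finset.sum_range_sub (fun t => g (y t ω)) N
  rw [← neg_sub (g (y N ω)), ← htel, ← sub_eq_add_neg, ← Finset.sum_sub_distrib]
  refine Finset.sum_congr rfl fun t _ => ?_
  rw [← hg]
  ring

theorem ae_tendsto_pathAverage [IsEmpty Z] {μ : Measure Ω} [IsProbabilityMeasure μ]
    {Phat : X → PMF (X ⊕ Z)} {ν : PMF X} {ξ : ℕ → Ω → X ⊕ Z} (h : IsTrajectory μ Phat ν ξ)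
    {d : X → ℝ}
    (hd : ∀ i j, Tendsto (fun t => occupation Phat (PMF.pure i) t j) atTop (𝓝 (d j)))
    (f : X → ℝ) :
    ∀ᵐ ω ∂μ, Tendsto (fun N => pathAverage (fun t => ξ t ω) N f) atTop (𝓝 (∑ j, d j * f j)) := by
  have hX : Nonempty X := ν.support_nonempty.to_type
  set y : ℕ → Ω → X := fun t ω => Equiv.sumEmpty X Z (ξ t ω) with hydef
  have hy : ∀ t ω, ξ t ω = Sum.inl (y t ω) := fun t ω =>
    ((Equiv.sumEmpty X Z).symm_apply_apply (ξ t ω)).symm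
  set m := ∑ j, d j * f j with hm
  have hf : ∑ j, d j * (f j - m) = 0 := by
    simp only [mul_sub, Finset.sum_sub_distrib]
    rw [← Finset.sum_mul, sum_eq_one_of_tendsto hd, ← hm, one_mul, sub_self]
  filter_upwards [ae_tendsto_average_of_centered h hy hd hf] with ω hω
  have hω' := hω.add_const m
  rw [zero_add] at hω'
  refine hω'.congr' ?_
  -- At `N = 0` the average is `0`, not `m`.
  filter_upwards [eventually_ge_atTop 1] with N hN
  have hN' : (N : ℝ) ≠ 0 := by positivity
  simp only [pathAverage, hy, Sum.elim_inl, Finset.sum_sub_distrib, Finset.sum_const,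
    Finset.card_range, nsmul_eq_mul]
  field_simp
  ring

end ErgodicAverage

/-! ### Episodes as functions of paths. -/

section EpisodePaths

variable {X Z : Type*}

/-- The sum of `f` along a path up to termination. -/
noncomputable def episodeSum (f : X → ℝ) (x : ℕ → X ⊕ Z) : ℝ :=
  ∑ t ∈ Finset.range (terminationTime x), Sum.elim f (fun _ => 0) (x t)

/-- The paths that terminate exactly after visiting `a 0, …, a n`. -/
def terminatingPaths (Z : Type*) (i : Σ n, Fin (n + 1) → X) : Set (ℕ → X ⊕ Z) :=
  {x | (∀ t : Fin (i.1 + 1), x t = Sum.inl (i.2 t)) ∧ ∃ z, x (i.1 + 1) = Sum.inr z}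

theorem terminationTime_eq {i : Σ n, Fin (n + 1) → X} {x : ℕ → X ⊕ Z}
    (hx : x ∈ terminatingPaths Z i) : terminationTime x = i.1 + 1 := by
  refine le_antisymm (Nat.sInf_le hx.2) ?_
  refine le_csInf ⟨_, hx.2⟩ ?_
  rintro t ⟨z, hz⟩
  by_contra hlt
  have := hx.1 ⟨t, not_le.1 hlt⟩
  simp [hz] at this

theorem episodeSum_eq {i : Σ n, Fin (n + 1) → X} {x : ℕ → X ⊕ Z}
    (hx : x ∈ terminatingPaths Z i) (f : X → ℝ) : episodeSum f x = ∑ t, f (i.2 t) := by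
  rw [episodeSum, terminationTime_eq hx, Finset.sum_range]
  exact Finset.sum_congr rfl fun t _ => by rw [hx.1 t, Sum.elim_inl]

theorem isLeft_of_lt_terminationTime {x : ℕ → X ⊕ Z} {t : ℕ} (ht : t < terminationTime x) :
    ∃ j, x t = Sum.inl j := by
  rcases hx : x t with j | z
  · exact ⟨j, rfl⟩
  · exact absurd ⟨z, hx⟩ (Nat.notMem_of_lt_sInf ht)

theorem exists_mem_terminatingPaths {x : ℕ → X ⊕ Z} (hx : terminationTime x ≠ 0) :
    ∃ i, x ∈ terminatingPaths Z i := by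
  obtain ⟨n, hn⟩ := Nat.exists_eq_succ_of_ne_zero hx
  choose a ha using fun t : Fin (n + 1) => isLeft_of_lt_terminationTime (t.2.trans_eq hn.symm)
  refine ⟨⟨n, a⟩, ha, ?_⟩
  have hne : {t | ∃ z, x t = Sum.inr z}.Nonempty := by
    by_contra h
    rw [Set.not_nonempty_iff_eq_empty] at h
    rw [terminationTime, h, Nat.sInf_empty] at hx
    exact hx rfl
  have := Nat.sInf_mem hne
  change ∃ z, x (terminationTime x) = Sum.inr z at this
  rwa [hn] at this

theorem pairwise_disjoint_terminatingPaths :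
    Pairwise (Function.onFun Disjoint (terminatingPaths (X := X) Z)) := by
  rintro ⟨n, a⟩ ⟨m, b⟩ hne
  refine Set.disjoint_left.2 fun x hx hy => hne ?_
  have h := (terminationTime_eq hx).symm.trans (terminationTime_eq hy)
  obtain rfl : n = m := Nat.succ_injective h
  congr
  funext t
  exact Sum.inl_injective ((hx.1 t).symm.trans (hy.1 t))

/-- Since `sInf ∅ = 0`, termination time `0` covers paths starting in a terminal state and paths
that never terminate. Their sum is `0`; every other path belongs to some `terminatingPaths Z i`. -/
theorem preimage_episodeSum (f : X → ℝ) {B : Set ℝ} (hB : (0 : ℝ) ∉ B) :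
    (episodeSum f : (ℕ → X ⊕ Z) → ℝ) ⁻¹' B =
      ⋃ i ∈ {i : Σ n, Fin (n + 1) → X | ∑ t, f (i.2 t) ∈ B}, terminatingPaths Z i := by
  ext x
  simp only [Set.mem_preimage, Set.mem_iUnion, Set.mem_ofPred_eq, exists_prop]
  constructor
  · intro hx
    have h0 : terminationTime x ≠ 0 := by
      intro h
      rw [episodeSum, h, Finset.range_zero, Finset.sum_empty] at hx
      exact hB hx
    obtain ⟨i, hi⟩ := exists_mem_terminatingPaths h0
    exact ⟨i, episodeSum_eq hi f ▸ hx, hi⟩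
  · rintro ⟨i, hi, hx⟩
    rwa [episodeSum_eq hx]

/-- The paths that visit `j` at time `t`, with no terminal state up to then. -/
def visitPaths (Z : Type*) (t : ℕ) (j : X) : Set (ℕ → X ⊕ Z) :=
  {x | (∀ s ≤ t, ∃ i, x s = Sum.inl i) ∧ x t = Sum.inl j}

/-- Termination is essential: on a path that never terminates, the termination time is `0` although
every state is non-terminal. -/
theorem lt_terminationTime_iff {x : ℕ → X ⊕ Z} (hx : ∃ t z, x t = Sum.inr z) (t : ℕ) :
    t < terminationTime x ↔ ∀ s ≤ t, ∃ i, x s = Sum.inl i := by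
  constructor
  · exact fun h s hs => isLeft_of_lt_terminationTime (hs.trans_lt h)
  · intro h
    obtain ⟨z, hz⟩ : ∃ z, x (terminationTime x) = Sum.inr z := Nat.sInf_mem hx
    by_contra hle
    obtain ⟨i, hi⟩ := h _ (not_lt.1 hle)
    simp [hi] at hz

theorem ofReal_episodeSum_single [DecidableEq X] {x : ℕ → X ⊕ Z} (hx : ∃ t z, x t = Sum.inr z)
    (j : X) : ENNReal.ofReal (episodeSum (Pi.single j 1) x) =
      ∑' t, (visitPaths Z t j).indicator (fun _ => 1) x := by
  classical
  have hterm : ∀ t < terminationTime x, ENNReal.ofReal (Sum.elim (Pi.single j 1 : X → ℝ)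
      (fun _ => 0) (x t)) = (visitPaths Z t j).indicator (fun _ => 1) x := by
    intro t ht
    obtain ⟨i, hi⟩ := isLeft_of_lt_terminationTime ht
    have hall := (lt_terminationTime_iff hx t).1 ht
    by_cases hij : i = j
    · subst hij
      have hmem : x ∈ visitPaths Z t i := ⟨hall, hi⟩
      simp [Set.indicator_of_mem hmem, hi]
    · simp [Set.indicator, visitPaths, hi, hij]
  rw [tsum_eq_sum (s := Finset.range (terminationTime x)), episodeSum, ENNReal.ofReal_sum_of_nonneg]
  · exact Finset.sum_congr rfl fun t ht => hterm t (Finset.mem_range.1 ht)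
  · intro t _
    rcases x t with i | z
    · exact (Pi.single_nonneg.2 zero_le_one : (0 : X → ℝ) ≤ Pi.single j 1) i
    · exact le_rfl
  · intro t ht
    refine Set.indicator_of_notMem (fun h => ht ?_) _
    exact Finset.mem_range.2 ((lt_terminationTime_iff hx t).2 h.1)

end EpisodePaths

/-! ### Laws and means of episode sums, and the strong law. -/

section EpisodeMeasurability

theorem measurable_of_preimage_of_zero_notMem {α : Type*} [MeasurableSpace α] {Y : α → ℝ}
    (h : ∀ B, MeasurableSet B → (0 : ℝ) ∉ B → MeasurableSet (Y ⁻¹' B)) : Measurable Y := by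
  intro B hB
  by_cases h0 : (0 : ℝ) ∈ B
  · rw [← compl_compl B, Set.preimage_compl]
    exact (h _ hB.compl fun hn => hn h0).compl
  · exact h B hB h0

variable {X Z Ω : Type*} [MeasurableSpace Ω] {μ : Measure Ω} {Phat : X → PMF (X ⊕ Z)} {ν : PMF X}

theorem measurable_path {ξ : ℕ → Ω → X ⊕ Z} (h : IsTrajectory μ Phat ν ξ) :
    @Measurable Ω (ℕ → X ⊕ Z) _ (@MeasurableSpace.pi _ _ fun _ => ⊤) fun ω t => ξ t ω := by
  let _ : MeasurableSpace (X ⊕ Z) := ⊤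
  exact measurable_pi_lambda _ h.measurable

theorem measurableSet_terminatingPaths {ξ : ℕ → Ω → X ⊕ Z} (h : IsTrajectory μ Phat ν ξ)
    (i : Σ n, Fin (n + 1) → X) : MeasurableSet {ω | (fun t => ξ t ω) ∈ terminatingPaths Z i} :=
  (measurableSet_prefix h i.1 i.2).inter
    (h.measurable (i.1 + 1) (MeasurableSpace.measurableSet_top
      (s := {s : X ⊕ Z | ∃ z, s = Sum.inr z})))

theorem measurableSet_visitPaths {ξ : ℕ → Ω → X ⊕ Z} (h : IsTrajectory μ Phat ν ξ) (t : ℕ)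
    (j : X) : MeasurableSet {ω | (fun s => ξ s ω) ∈ visitPaths Z t j} := by
  have hset : {ω | (fun s => ξ s ω) ∈ visitPaths Z t j} =
      (⋂ s : ℕ, ⋂ _ : s ≤ t, ξ s ⁻¹' {c | ∃ i, c = Sum.inl i}) ∩ {ω | ξ t ω = Sum.inl j} := by
    ext ω
    simp [visitPaths]
  rw [hset]
  exact (MeasurableSet.iInter fun s => MeasurableSet.iInter fun _ =>
    h.measurable s MeasurableSpace.measurableSet_top).inter (measurableSet_trajectory_eq h t _)

variable [Fintype X]

theorem measurable_episodeSum (f : X → ℝ) :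
    @Measurable (ℕ → X ⊕ Z) ℝ (@MeasurableSpace.pi _ _ fun _ => ⊤) _ (episodeSum f) := by
  let _ : MeasurableSpace (X ⊕ Z) := ⊤
  refine measurable_of_preimage_of_zero_notMem fun B _ h0 => ?_
  rw [preimage_episodeSum f h0]
  refine MeasurableSet.biUnion (Set.to_countable _) fun i _ => ?_
  have hset : terminatingPaths Z i = (⋂ t : Fin (i.1 + 1), (fun x : ℕ → X ⊕ Z => x t) ⁻¹'
      {Sum.inl (i.2 t)}) ∩ (fun x : ℕ → X ⊕ Z => x (i.1 + 1)) ⁻¹' {s | ∃ z, s = Sum.inr z} := by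
    ext x
    simp [terminatingPaths]
  rw [hset]
  have hm : ∀ t : ℕ, Measurable fun x : ℕ → X ⊕ Z => x t := fun t => measurable_pi_apply t
  exact (MeasurableSet.iInter fun t : Fin (i.1 + 1) => hm t MeasurableSpace.measurableSet_top).inter
    (hm (i.1 + 1) MeasurableSpace.measurableSet_top)

theorem measurable_episodeSum_comp {ξ : ℕ → Ω → X ⊕ Z} (h : IsTrajectory μ Phat ν ξ)
    (f : X → ℝ) : Measurable fun ω => episodeSum f fun t => ξ t ω :=
  @Measurable.comp _ _ _ _ (@MeasurableSpace.pi _ _ fun _ => ⊤) _ _ _ (measurable_episodeSum f)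
    (measurable_path h)

variable [IsProbabilityMeasure μ]

/-- `Z` may be uncountable, so the probability is found by subtracting the finitely many
non-terminal continuations instead of summing over terminal states. -/
theorem measureReal_terminatingPaths {ξ : ℕ → Ω → X ⊕ Z} (h : IsTrajectory μ Phat ν ξ)
    (i : Σ n, Fin (n + 1) → X) : μ.real {ω | (fun t => ξ t ω) ∈ terminatingPaths Z i} =
      pathProb Phat ν i.1 i.2 - ∑ b, pathProb Phat ν (i.1 + 1) (Fin.snoc i.2 b) := by
  obtain ⟨n, a⟩ := i
  have hsnoc : ∀ b ω, (∀ t : Fin (n + 2), ξ t ω = Sum.inl ((Fin.snoc a b : Fin (n + 2) → X) t)) ↔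
      (∀ t : Fin (n + 1), ξ t ω = Sum.inl (a t)) ∧ ξ (n + 1) ω = Sum.inl b := by
    intro b ω
    rw [Fin.forall_fin_succ']
    simp only [Fin.snoc_castSucc (α := fun _ => X), Fin.snoc_last (α := fun _ => X),
      Fin.val_castSucc, Fin.val_last]
  have hunion : μ.real (⋃ b ∈ Finset.univ, {ω | ∀ t : Fin (n + 2),
      ξ t ω = Sum.inl ((Fin.snoc a b : Fin (n + 2) → X) t)}) =
      ∑ b, pathProb Phat ν (n + 1) (Fin.snoc a b) := by
    rw [measureReal_biUnion_finset]
    · exact Finset.sum_congr rfl fun b _ => measureReal_prefix h (n + 1) _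
    · intro b _ b' _ hne
      refine Set.disjoint_left.2 fun ω hω hω' => hne ?_
      exact Sum.inl_injective (((hsnoc b ω).1 hω).2.symm.trans ((hsnoc b' ω).1 hω').2)
    · exact fun b _ => measurableSet_prefix h (n + 1) _
  have hdiff : {ω | (fun t => ξ t ω) ∈ terminatingPaths Z ⟨n, a⟩} =
      {ω | ∀ t : Fin (n + 1), ξ t ω = Sum.inl (a t)} \ ⋃ b ∈ Finset.univ, {ω | ∀ t : Fin (n + 2),
        ξ t ω = Sum.inl ((Fin.snoc a b : Fin (n + 2) → X) t)} := by
    ext ω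
    simp only [Set.mem_sdiff, Set.mem_iUnion, Finset.mem_univ, Set.mem_ofPred_eq, hsnoc,
      terminatingPaths, exists_prop, true_and, not_exists, not_and]
    refine and_congr_right fun hω => ⟨?_, fun hn => ?_⟩
    · rintro ⟨z, hz⟩ b _ hb
      simp [hz] at hb
    · rcases hx : ξ (n + 1) ω with b | z
      · exact absurd hx (hn b hω)
      · exact ⟨z, rfl⟩
  rw [hdiff, measureReal_sdiff, hunion, measureReal_prefix h]
  · refine Set.iUnion₂_subset fun b _ ω hω => ((hsnoc b ω).1 hω).1
  · exact MeasurableSet.biUnion (Set.to_countable _) fun b _ => measurableSet_prefix h (n + 1) _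

/-- Preimages of sets avoiding `0` are countable disjoint unions of terminating-path events, whose
probabilities depend only on `Phat` and `ν`. Sets containing `0` follow by complement, both laws
having mass one. -/
theorem identDistrib_episodeSum {ξ ξ' : ℕ → Ω → X ⊕ Z} (h : IsTrajectory μ Phat ν ξ)
    (h' : IsTrajectory μ Phat ν ξ') (f : X → ℝ) :
    IdentDistrib (fun ω => episodeSum f fun t => ξ t ω)
      (fun ω => episodeSum f fun t => ξ' t ω) μ μ := by
  have hm := measurable_episodeSum_comp h f
  have hm' := measurable_episodeSum_comp h' f
  have hmeas : ∀ {ζ : ℕ → Ω → X ⊕ Z}, IsTrajectory μ Phat ν ζ → ∀ B : Set ℝ, (0 : ℝ) ∉ B →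
      μ ((fun ω => episodeSum f fun t => ζ t ω) ⁻¹' B) =
        ∑' i : {i : Σ n, Fin (n + 1) → X | ∑ t, f (i.2 t) ∈ B}, ENNReal.ofReal
          (pathProb Phat ν i.1.1 i.1.2 - ∑ b, pathProb Phat ν (i.1.1 + 1) (Fin.snoc i.1.2 b)) := by
    intro ζ hζ B h0
    have hpre : (fun ω => episodeSum f fun t => ζ t ω) ⁻¹' B =
        ⋃ i ∈ {i : Σ n, Fin (n + 1) → X | ∑ t, f (i.2 t) ∈ B},
          {ω | (fun t => ζ t ω) ∈ terminatingPaths Z i} := by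
      have := congrArg (fun S => (fun ω t => ζ t ω) ⁻¹' S) (preimage_episodeSum (Z := Z) f h0)
      simp only [Set.preimage_iUnion] at this
      exact this
    rw [hpre, measure_biUnion (Set.to_countable _)]
    · refine tsum_congr fun i => ?_
      rw [← measureReal_terminatingPaths hζ, ofReal_measureReal]
    · intro i _ j _ hij
      have hdisj : Disjoint (terminatingPaths Z i) (terminatingPaths Z j) :=
        pairwise_disjoint_terminatingPaths hij
      exact hdisj.preimage fun ω t => ζ t ω
    · exact fun i _ => measurableSet_terminatingPaths hζ i
  refine ⟨hm.aemeasurable, hm'.aemeasurable, ?_⟩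
  have h1 := Measure.isProbabilityMeasure_map (μ := μ) hm.aemeasurable
  have h2 := Measure.isProbabilityMeasure_map (μ := μ) hm'.aemeasurable
  have key : ∀ B : Set ℝ, MeasurableSet B → (0 : ℝ) ∉ B →
      μ.map (fun ω => episodeSum f fun t => ξ t ω) B =
        μ.map (fun ω => episodeSum f fun t => ξ' t ω) B := by
    intro B hB h0
    rw [Measure.map_apply hm hB, Measure.map_apply hm' hB, hmeas h B h0, hmeas h' B h0]
  refine Measure.ext fun B hB => ?_
  by_cases h0 : (0 : ℝ) ∈ B
  · rw [← compl_compl B, prob_compl_eq_one_sub hB.compl, prob_compl_eq_one_sub hB.compl,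
      key _ hB.compl fun hn => hn h0]
  · exact key B hB h0

theorem measureReal_visitPaths {ξ : ℕ → Ω → X ⊕ Z} (h : IsTrajectory μ Phat ν ξ) (t : ℕ)
    (j : X) : μ.real {ω | (fun s => ξ s ω) ∈ visitPaths Z t j} = occupation Phat ν t j := by
  classical
  have hset : {ω | (fun s => ξ s ω) ∈ visitPaths Z t j} =
      ⋃ a ∈ Finset.univ.filter fun a : Fin (t + 1) → X => a (Fin.last t) = j,
        {ω | ∀ s : Fin (t + 1), ξ s ω = Sum.inl (a s)} := by
    ext ω
    simp only [Set.mem_iUnion, Finset.mem_filter, Finset.mem_univ, true_and, Set.mem_ofPred_eq,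
      visitPaths, exists_prop]
    constructor
    · rintro ⟨hω, hj⟩
      choose a ha using fun s : Fin (t + 1) => hω s (Nat.lt_succ_iff.1 s.2)
      refine ⟨a, Sum.inl_injective ((ha (Fin.last t)).symm.trans hj), ha⟩
    · rintro ⟨a, rfl, ha⟩
      exact ⟨fun s hs => ⟨_, ha ⟨s, Nat.lt_succ_of_le hs⟩⟩, ha (Fin.last t)⟩
  rw [hset, measureReal_biUnion_finset]
  · rw [Finset.sum_congr rfl fun a _ => measureReal_prefix h t a, Finset.sum_filter]
    have := sum_pathProb_mul Phat ν t fun i => if i = j then 1 else 0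
    simpa using this
  · intro a _ b _ hne
    refine Set.disjoint_left.2 fun ω hω hω' => hne ?_
    funext s
    exact Sum.inl_injective ((hω s).symm.trans (hω' s))
  · exact fun a _ => measurableSet_prefix h t a

/-- For every `t`, never terminating implies being in a non-terminal state at time `t`; the
probability of this tends to zero, since the occupations are summable. -/
theorem ae_exists_terminal {ξ : ℕ → Ω → X ⊕ Z} (h : IsTrajectory μ Phat ν ξ) {d : X → ℝ}
    (hd : ∀ j, HasSum (fun t => occupation Phat ν t j) (d j)) :
    ∀ᵐ ω ∂μ, ∃ t z, ξ t ω = Sum.inr z := by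
  rw [ae_iff]
  have hle : ∀ t, μ.real {ω | ¬∃ t z, ξ t ω = Sum.inr z} ≤ ∑ j, occupation Phat ν t j := by
    intro t
    have hsub : {ω | ¬∃ t z, ξ t ω = Sum.inr z} ⊆
        ⋃ j ∈ Finset.univ, {ω | (fun s => ξ s ω) ∈ visitPaths Z t j} := by
      intro ω hω
      have hl : ∀ s, ∃ i, ξ s ω = Sum.inl i := by
        intro s
        rcases hx : ξ s ω with i | z
        · exact ⟨i, rfl⟩
        · exact absurd ⟨s, z, hx⟩ hω
      obtain ⟨j, hj⟩ := hl t
      exact Set.mem_biUnion (Finset.mem_univ j) ⟨fun s _ => hl s, hj⟩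
    refine (measureReal_mono hsub (measure_ne_top _ _)).trans ((measureReal_biUnion_finset_le _ _).trans ?_)
    exact le_of_eq (Finset.sum_congr rfl fun j _ => measureReal_visitPaths h t j)
  have hlim : Tendsto (fun t => ∑ j, occupation Phat ν t j) atTop (𝓝 0) := by
    simpa using tendsto_finsetSum Finset.univ fun j _ => (hd j).summable.tendsto_atTop_zero
  have h0 := le_antisymm (ge_of_tendsto' hlim hle) measureReal_nonneg
  exact (measureReal_eq_zero_iff).1 h0

/-- Almost surely the visit count is a sum of visit indicators over time, and Tonelli exchanges this
sum with the expectation. This also yields integrability. -/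
theorem integral_episodeSum_single [DecidableEq X] {ξ : ℕ → Ω → X ⊕ Z}
    (h : IsTrajectory μ Phat ν ξ) {d : X → ℝ}
    (hd : ∀ j, HasSum (fun t => occupation Phat ν t j) (d j)) (j : X) :
    Integrable (fun ω => episodeSum (Pi.single j 1) fun t => ξ t ω) μ ∧
      ∫ ω, episodeSum (Pi.single j 1) (fun t => ξ t ω) ∂μ = d j := by
  have hm := measurable_episodeSum_comp h (Pi.single j 1)
  have hnn : ∀ ω, 0 ≤ episodeSum (Pi.single j 1) fun t => ξ t ω := by
    intro ω
    refine Finset.sum_nonneg fun t _ => ?_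
    change 0 ≤ Sum.elim (Pi.single j 1 : X → ℝ) (fun _ => 0) (ξ t ω)
    rcases ξ t ω with i | z
    · exact (Pi.single_nonneg.2 zero_le_one : (0 : X → ℝ) ≤ Pi.single j 1) i
    · exact le_rfl
  have hl : ∫⁻ ω, ENNReal.ofReal (episodeSum (Pi.single j 1) fun t => ξ t ω) ∂μ =
      ENNReal.ofReal (d j) := by
    have hae : ∀ᵐ ω ∂μ, ENNReal.ofReal (episodeSum (Pi.single j 1) fun t => ξ t ω) =
        ∑' t, {ω | (fun s => ξ s ω) ∈ visitPaths Z t j}.indicator (fun _ => 1) ω := by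
      filter_upwards [ae_exists_terminal h hd] with ω hω
      exact ofReal_episodeSum_single hω j
    rw [lintegral_congr_ae hae, lintegral_tsum fun t =>
      (measurable_const.indicator (measurableSet_visitPaths h t j)).aemeasurable]
    have hterm : ∀ t, ∫⁻ ω, {ω | (fun s => ξ s ω) ∈ visitPaths Z t j}.indicator
        (fun _ => (1 : ENNReal)) ω ∂μ = ENNReal.ofReal (occupation Phat ν t j) := by
      intro t
      rw [lintegral_indicator (measurableSet_visitPaths h t j), setLIntegral_const, one_mul,
        ← measureReal_visitPaths h, ofReal_measureReal]
    simp only [hterm]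
    rw [← ENNReal.ofReal_tsum_of_nonneg (fun t => occupation_nonneg _ _ _ _) (hd j).summable,
      (hd j).tsum_eq]
  have hd0 : 0 ≤ d j := (hd j).nonneg fun t => occupation_nonneg _ _ _ _
  refine ⟨(lintegral_ofReal_ne_top_iff_integrable hm.aestronglyMeasurable
    (Eventually.of_forall hnn)).1 (hl ▸ ENNReal.ofReal_ne_top), ?_⟩
  rw [integral_eq_lintegral_of_nonneg_ae (Eventually.of_forall hnn) hm.aestronglyMeasurable, hl,
    ENNReal.toReal_ofReal hd0]

theorem ae_tendsto_episodeAverage_single [DecidableEq X] {ξ : ℕ → ℕ → Ω → X ⊕ Z}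
    (h : ∀ m, IsTrajectory μ Phat ν (ξ m)) (hind : IndepTrajectories μ ξ) {d : X → ℝ}
    (hd : ∀ j, HasSum (fun t => occupation Phat ν t j) (d j)) (j : X) :
    ∀ᵐ ω ∂μ, Tendsto (fun N => episodeAverage (fun m t => ξ m t ω) N (Pi.single j 1)) atTop
      (𝓝 (d j)) := by
  have hI := integral_episodeSum_single (h 0) hd j
  have hpair : Pairwise (Function.onFun (fun f g => IndepFun f g μ)
      fun m ω => episodeSum (Pi.single j 1 : X → ℝ) fun t => ξ m t ω) := by
    intro m n hmn
    let _ : MeasurableSpace (X ⊕ Z) := ⊤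
    have h1 : iIndepFun (fun m ω t => ξ m t ω) μ := hind
    exact (h1.indepFun hmn).comp (measurable_episodeSum _) (measurable_episodeSum _)
  have hslln := strong_law_ae_real
    (fun m ω => episodeSum (Pi.single j 1 : X → ℝ) fun t => ξ m t ω) hI.1 hpair
    fun m => identDistrib_episodeSum (h m) (h 0) _
  filter_upwards [hslln] with ω hω
  rw [hI.2] at hω
  refine hω.congr fun N => ?_
  rw [episodeAverage, div_eq_inv_mul, one_div]
  rfl

end EpisodeMeasurability

/-! ### Averages as visit frequencies, and the conclusion. -/

section Averages

variable {X Z : Type*}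

/-- Expresses the average through the frequencies of single states, the form required by
`tendsto_sampledRPVI`. -/
theorem pathAverage_eq_sum [Fintype X] [DecidableEq X] (x : ℕ → X ⊕ Z) (N : ℕ) (f : X → ℝ) :
    pathAverage x N f = ∑ j, pathAverage x N (Pi.single j 1) * f j := by
  simp only [pathAverage, mul_assoc, ← Finset.mul_sum, Finset.sum_mul]
  congr 1
  rw [Finset.sum_comm]
  refine Finset.sum_congr rfl fun t _ => ?_
  rcases x t with i | z
  · simp [Pi.single_apply]
  · simp

theorem episodeAverage_eq_sum [Fintype X] [DecidableEq X] (x : ℕ → ℕ → X ⊕ Z) (N : ℕ)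
    (f : X → ℝ) : episodeAverage x N f = ∑ j, episodeAverage x N (Pi.single j 1) * f j := by
  simp only [episodeAverage, mul_assoc, ← Finset.mul_sum, Finset.sum_mul]
  congr 1
  rw [Finset.sum_comm]
  refine Finset.sum_congr rfl fun m _ => ?_
  rw [Finset.sum_comm]
  refine Finset.sum_congr rfl fun t _ => ?_
  rcases x m t with i | z
  · simp [Pi.single_apply]
  · simp

theorem ExplorationAssumption.pos_and_superinvariant [Fintype X] {Phat : X → PMF (X ⊕ Z)}
    {ν : PMF X} {d : X → ℝ} (h : ExplorationAssumption Phat ν d) :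
    (∀ j, 0 < d j) ∧ ∀ j, ∑ i, d i * transitionMatrix Phat i j ≤ d j := by
  rcases h with ⟨-, hpos, hlim⟩ | ⟨-, hterm, hvisit, hd⟩
  · exact ⟨hpos, fun j => (sum_mul_transitionMatrix_eq_of_tendsto hlim j).le⟩
  · have hs := hasSum_occupation hterm hd
    exact ⟨pos_of_hasSum_occupation hs hvisit, sum_mul_transitionMatrix_le_of_hasSum hs⟩

end Averages

theorem mainTheorem3 {X Z U Ω : Type*} [Fintype X] [MeasurableSpace Ω]
    (μ : Measure Ω) [IsProbabilityMeasure μ]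
    (M : RobustMDP X Z U) (π : X → U) (Phat : X → PMF (X ⊕ Z)) (ν : PMF X) (d : X → ℝ)
    {K : ℕ} (Φ : Matrix X (Fin K) ℝ) (hΦ : LinearIndependent ℝ Φ.col)
    (hExpl : ExplorationAssumption Phat ν d) (hDom : DominationAssumption M π Phat) :
    ∃ wstar : Fin K → ℝ,
      (∀ V : X → ℝ, V = weightedProj d Φ (robustBellman M π V) ↔ V = Φ.mulVec wstar) ∧
      (IsEmpty Z → ∀ ξ : ℕ → Ω → X ⊕ Z, IsTrajectory μ Phat ν ξ →
        ∀ w₀ : Fin K → ℝ, ∀ᵐ ω ∂μ,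
          Tendsto (fun q : ℕ × ℕ =>
              sampledRPVI M π Φ (pathAverage (fun t => ξ t ω) q.1) w₀ q.2)
            (atTop ×ˢ atTop) (𝓝 wstar)) ∧
      (Nonempty Z → ∀ ξ : ℕ → ℕ → Ω → X ⊕ Z, (∀ m, IsTrajectory μ Phat ν (ξ m)) →
        IndepTrajectories μ ξ →
        ∀ w₀ : Fin K → ℝ, ∀ᵐ ω ∂μ,
          Tendsto (fun q : ℕ × ℕ =>
              sampledRPVI M π Φ (episodeAverage (fun m t => ξ m t ω) q.1) w₀ q.2)
            (atTop ×ˢ atTop) (𝓝 wstar)) := by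
  classical
  obtain ⟨hd, hdP⟩ := ExplorationAssumption.pos_and_superinvariant hExpl
  obtain ⟨β, hβ0, hβ1, hdom⟩ := hDom
  have hT := weightedNorm_robustBellman_sub_le M π hd (transitionMatrix_nonneg Phat)
    (fun i => sum_toReal_inl_le_one (Phat i)) hdP hβ0.le hdom
  obtain ⟨wstar, hw⟩ := exists_projected_fixedPoint M π hd hΦ hβ0.le hβ1 hT
  refine ⟨wstar, hw, fun hZ ξ hξ w₀ => ?_, fun hZ ξ hξ hind w₀ => ?_⟩
  · rcases hExpl with ⟨-, -, hlim⟩ | ⟨hZ', -⟩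
    · filter_upwards [ae_all_iff.2 fun j => ae_tendsto_pathAverage hξ hlim (Pi.single j 1)]
        with ω hω
      have hc : Tendsto (fun N j => pathAverage (fun t => ξ t ω) N (Pi.single j 1)) atTop (𝓝 d) :=
        tendsto_pi_nhds.2 fun j => by simpa [Pi.single_apply] using hω j
      have h := tendsto_sampledRPVI M π hd hΦ hβ0.le hβ1 hT ((hw _).2 rfl) hc w₀
      simpa only [← pathAverage_eq_sum] using h
    · exact (not_isEmpty_iff.2 hZ' hZ).elim
  · rcases hExpl with ⟨hZ', -⟩ | ⟨-, hterm, -, hdsum⟩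
    · exact (not_isEmpty_iff.2 hZ hZ').elim
    · have hs := hasSum_occupation hterm hdsum
      filter_upwards [ae_all_iff.2 fun j => ae_tendsto_episodeAverage_single hξ hind hs j]
        with ω hω
      have h := tendsto_sampledRPVI M π hd hΦ hβ0.le hβ1 hT ((hw _).2 rfl)
        (tendsto_pi_nhds.2 hω) w₀
      simpa only [← episodeAverage_eq_sum] using h
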